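/- **Proposition (4-stage schemes in EES(2,7)).** Let $\mathcal H$ be the Butcher--Connes--Kreimer Hopf algebra: the free commutative $\mathbb R$-algebra on the non-empty non-planar rooted trees $\tau$ (the empty forest $\emptyset$ being the unit), with coproduct $\Delta(\tau)=\tau\otimes\emptyset+\emptyset\otimes\tau+\sum_c P_c(\tau)\otimes R_c(\tau)$, the sum being over the admissible cuts $c$ that are neither empty nor total, and antipode $S(\tau)=\sum_{c}(-1)^{|c|+1}\tau^c$, the sum being over all sets $c$ of edges, where $\tau^c$ is the forest left after removing $c$. Let $\mathrm{Id}^{1/2}$ be the multiplicative square root of $\mathrm{Id}$ for the convolution product $fg=\mu\circ(f\otimes g)\circ\Delta$, let $\bar S(\tau)=(-1)^{|\tau|}S(\tau)$, and put $$\tau^-=\mu\circ(\bar S\otimes\mathrm{Id})\circ\Delta\circ\mathrm{Id}^{1/2}(\tau),\qquad \tau^+=\mu\circ(\mathrm{Id}\otimes(\cdot)^-\circ S)\circ\Delta(\tau).$$ A Runge--Kutta scheme with matrix $(a_{ij})$, weights $(b_i)$ and elementary weights $\psi(\tau)$ (extended multiplicatively to $\mathcal H$) belongs to $\mathrm{EES}(n,m)$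 if it is explicit ($a_{ij}=0$ for $j\ge i$), $\sup\{k\in\mathbb N:\psi(\tau)=1/\tau!\ \text{for all }|\tau|\le k\}=n$ and $\sup\{k\in\mathbb N:\psi(\tau^+)=0\ \text{for all }|\tau|\le k\}=m$, where $\tau$ runs over non-empty trees. A $4$-stage Runge--Kutta scheme belongs to $\mathrm{EES}(2,7)$ if and only if it is explicit and there are $s\in\{\sqrt2,-\sqrt2\}$ and $x\in\mathbb R$ with $x\notin\{1,\ \tfrac12,\ \tfrac{1-s}2,\ \tfrac{2-s}2,\ -\tfrac s2\}$ such that, with $$\alpha=\frac{2x+s}{(2x-1)(-2x-s+1)},\qquad \beta=\frac1{(2x-1)(1-s-2x)(2-s-2x)},$$ one has $$b_1=x,\quad b_2=\tfrac12(2-s)-(1-s)x,\quad b_3=(1-s)(x-1),\quad b_4=\tfrac12(2-s)-x,$$ $$a_{21}=\frac{-2+s(1-2x)}{4(x-1)},\quad a_{31}=\frac{(2x+s-2)(4x+s-2)}{4s(x-1)}\,\alpha,\quad a_{32}=\tfrac12(-1+s)\,\alpha,$$ $$a_{41}=\frac{-40x^4+(80-40s)x^3-(88-60s)x^2+(48-34s)x+7s-10}{2(x-1)(2x+s)}\,\beta,$$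 $$a_{42}=(2-s)\,x(x-1)(4x+s-2)\,\beta,\qquad a_{43}=\frac{(2-s)(x-1)(2x-1)}{(2x+s)(2-s-2x)}.$$ -/

import Mathlib

open scoped TensorProduct

/-! ## Non-planar rooted trees -/

/-- Ordered (planar) rooted trees: a root with a finite list of branches. -/
inductive PlanarTree : Type
  | node : List PlanarTree → PlanarTree

namespace PlanarTree

/-- Two ordered trees are isomorphic as (unordered) rooted trees: the equivalence relation generated
by permuting the branches at the root and by replacing a branch by an isomorphic one. -/
inductive Iso : PlanarTree → PlanarTree → Prop
  | perm {l l' : List PlanarTree} : l.Perm l' → Iso (node l) (node l')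
  | branch {t t' : PlanarTree} (l : List PlanarTree) : Iso t t' → Iso (node (t :: l)) (node (t' :: l))
  | symm {t t' : PlanarTree} : Iso t t' → Iso t' t
  | trans {t t' t'' : PlanarTree} : Iso t t' → Iso t' t'' → Iso t t''

theorem Iso.refl : ∀ t : PlanarTree, Iso t t
  | node l => Iso.perm (List.Perm.refl l)

instance setoid : Setoid PlanarTree :=
  ⟨Iso, Iso.refl, Iso.symm, Iso.trans⟩

end PlanarTree

/-- Non-empty, unlabelled, non-planar rooted trees. -/
def RTree : Type := Quotient PlanarTree.setoid

/-- A forest is a finite multiset of non-empty trees; `0` is the empty forest `∅`. -/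
abbrev Forest : Type := Multiset RTree

namespace PlanarTree

/-- The class of an ordered tree. -/
def toRooted (t : PlanarTree) : RTree := Quotient.mk setoid t

mutual
/-- Recursion on ordered trees by a rule that sees only the multiset of branches. -/
def recurse {X : Type} (g : Multiset (RTree × X) → X) : PlanarTree → X
  | node l => g (recurseList g l)
/-- The branches in a list, each together with its recursive value. -/
def recurseList {X : Type} (g : Multiset (RTree × X) → X) :
    List PlanarTree → Multiset (RTree × X)
  | [] => 0
  | t :: l => (t.toRooted, recurse g t) ::ₘ recurseList g l
end

theorem recurseList_eq {X : Type} (g : Multiset (RTree × X) → X) (l : List PlanarTree) :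
    recurseList g l = ((l.map fun t => (t.toRooted, recurse g t) : List (RTree × X)) :
      Multiset (RTree × X)) := by
  induction l with
  | nil => simp [recurseList]
  | cons t l ih => simp [recurseList, ih]

theorem recurse_iso {X : Type} (g : Multiset (RTree × X) → X) {t t' : PlanarTree}
    (h : Iso t t') : recurse g t = recurse g t' := by
  induction h with
  | perm h =>
    simp only [recurse, recurseList_eq]
    exact congrArg g (Multiset.coe_eq_coe.2 (h.map _))
  | branch l h ih =>
    have e := Quotient.sound (s := setoid) h
    simp only [recurse, recurseList, ih]
    unfold toRooted
    rw [e]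
  | symm _ ih => exact ih.symm
  | trans _ _ ih₁ ih₂ => exact ih₁.trans ih₂

end PlanarTree

namespace RTree

/-- An ordered tree representing a given tree. -/
noncomputable def out (τ : RTree) : PlanarTree := Quotient.out (s := PlanarTree.setoid) τ

theorem toRooted_out (τ : RTree) : (out τ).toRooted = τ := Quotient.out_eq τ

theorem out_toRooted_iso (t : PlanarTree) : PlanarTree.Iso (out t.toRooted) t :=
  Quotient.mk_out (s := PlanarTree.setoid) t

/-- `node {τ₁, …, τₖ} = [τ₁, …, τₖ]`: the trees are joined to a new root. -/
noncomputable def node (F : Forest) : RTree :=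
  (PlanarTree.node (F.toList.map out)).toRooted

/-- Recursion on rooted trees: the value at `[τ₁, …, τₖ]` is computed from the branches and the values
at the branches, see `recurse_node`. -/
def recurse {X : Type} (g : Multiset (RTree × X) → X) (τ : RTree) : X :=
  Quotient.lift (PlanarTree.recurse g) (fun _ _ h => PlanarTree.recurse_iso g h) τ

theorem recurse_node {X : Type} (g : Multiset (RTree × X) → X) (F : Forest) :
    recurse g (node F) = g (F.map fun τ => (τ, recurse g τ)) := by
  have key : ∀ τ : RTree,
      ((out τ).toRooted, PlanarTree.recurse g (out τ)) = (τ, recurse g τ) := by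
    intro τ
    have h : recurse g (out τ).toRooted = PlanarTree.recurse g (out τ) := rfl
    rw [← h, toRooted_out]
  have h1 : recurse g (node F) = PlanarTree.recurse g (PlanarTree.node (F.toList.map out)) := rfl
  have h2 : ((fun t => (t.toRooted, PlanarTree.recurse g t)) ∘ out) =
      fun τ : RTree => (τ, recurse g τ) := funext key
  rw [h1, PlanarTree.recurse, PlanarTree.recurseList_eq, List.map_map, h2,
    ← Multiset.map_coe, Multiset.coe_toList]

/-- Every tree is `[τ₁, …, τₖ]` for some forest. -/
theorem exists_eq_node (τ : RTree) : ∃ F : Forest, τ = node F := by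
  obtain ⟨⟨l⟩, rfl⟩ := Quotient.exists_rep τ
  refine ⟨(l.map PlanarTree.toRooted : List RTree), Quotient.sound (s := PlanarTree.setoid) ?_⟩
  have hl : ∀ l₁ l₂ l₃ : List PlanarTree, List.Forall₂ PlanarTree.Iso l₁ l₂ →
      PlanarTree.Iso (.node (l₁ ++ l₃)) (.node (l₂ ++ l₃)) := by
    intro l₁ l₂ l₃ h
    induction h generalizing l₃ with
    | nil => exact PlanarTree.Iso.refl _
    | @cons a b u v hab _ ih =>
      refine (PlanarTree.Iso.branch (u ++ l₃) hab).trans ?_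
      refine (PlanarTree.Iso.perm (l' := u ++ (b :: l₃)) List.perm_middle.symm).trans ?_
      exact (ih (b :: l₃)).trans (PlanarTree.Iso.perm List.perm_middle)
  have hp : (Multiset.toList (l.map PlanarTree.toRooted : List RTree)).Perm
      (l.map PlanarTree.toRooted) := by
    rw [← Multiset.coe_eq_coe, Multiset.coe_toList]
  have hr : List.Forall₂ PlanarTree.Iso l ((l.map PlanarTree.toRooted).map out) := by
    rw [List.map_map, List.forall₂_map_right_iff, List.forall₂_same]
    exact fun t _ => (out_toRooted_iso t).symm
  have h := hl _ _ [] hr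
  rw [List.append_nil, List.append_nil] at h
  exact h.trans (PlanarTree.Iso.perm (hp.symm.map _))

/-- The branches of a tree. -/
def branches : RTree → Forest := recurse fun B => B.map Prod.fst

@[simp] theorem branches_node (F : Forest) : branches (node F) = F := by
  rw [branches, recurse_node]
  simp

/-- The number `|τ|` of nodes. -/
def size : RTree → ℕ := recurse fun B => 1 + (B.map Prod.snd).sum

theorem size_node (F : Forest) : size (node F) = 1 + (F.map size).sum := by
  simp [size, recurse_node]

theorem size_pos (τ : RTree) : 0 < size τ := by
  obtain ⟨F, rfl⟩ := exists_eq_node τ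
  rw [size_node]
  omega

theorem size_lt_of_mem {F : Forest} {τ : RTree} (h : τ ∈ F) : size τ < size (node F) := by
  rw [size_node]
  have := Multiset.single_le_sum (s := F.map size) (fun _ _ => Nat.zero_le _) _
    (Multiset.mem_map_of_mem size h)
  omega

/-- Structural induction on rooted trees. -/
theorem induction {p : RTree → Prop} (h : ∀ F : Forest, (∀ τ ∈ F, p τ) → p (node F))
    (τ : RTree) : p τ := by
  induction hn : size τ using Nat.strong_induction_on generalizing τ with
  | _ n ih =>
    obtain ⟨F, rfl⟩ := exists_eq_node τ
    exact h F fun σ hσ => ih _ (hn ▸ size_lt_of_mem hσ) σ rfl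

/-- The tree factorial: `[τ₁, …, τₖ]! = |[τ₁, …, τₖ]| · τ₁! ⋯ τₖ!`. -/
def factorial : RTree → ℕ :=
  recurse fun B => (1 + (B.map fun q => size q.1).sum) * (B.map Prod.snd).prod

/-- The cuts of `τ` (subsets `c` of its edges), each recorded as `(|c|, P_c, R_c)`: the number of edges
in the cut, the forest of the components without the root, and the component of the root.
For each branch `σ` of the root one decides whether its edge to the root belongs to the cut, and chooses
a cut of `σ`; then the root component of `σ` is either split off or remains a branch of the root. -/
noncomputable def cuts : RTree → Multiset (ℕ × Forest × RTree) :=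
  recurse fun B =>
    (B.map fun q : RTree × Multiset (ℕ × Forest × RTree) =>
      (q.2.map fun c => ((c.1 + 1, c.2.1 + {c.2.2}, 0) : ℕ × Forest × Forest)) +
      (q.2.map fun c => ((c.1, c.2.1, {c.2.2}) : ℕ × Forest × Forest))).Sections.map
    fun s => (s.sum.1, s.sum.2.1, node s.sum.2.2)

/-- The admissible cuts of `τ` other than the total cut, each recorded as `(P_c, R_c)`; a path from the
root meets at most one edge of the cut. For each branch `σ` of the root, either its edge to the root is
cut, and then no edge of `σ` is, or it is not, and an admissible cut of `σ` is chosen. The empty cut is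
recorded as `(0, τ)`. -/
noncomputable def admissibleCuts : RTree → Multiset (Forest × RTree) :=
  recurse fun B =>
    (B.map fun q : RTree × Multiset (Forest × RTree) =>
      (({q.1}, 0) : Forest × Forest) ::ₘ
        q.2.map fun c => ((c.1, {c.2}) : Forest × Forest)).Sections.map
    fun s => (s.sum.1, node s.sum.2)

open scoped Classical in
/-- `Adm(τ)`: the admissible cuts that are neither total nor empty. -/
noncomputable def properCuts (τ : RTree) : Multiset (Forest × RTree) :=
  (admissibleCuts τ).filter fun c => c.1 ≠ 0

theorem cuts_node (F : Forest) : cuts (node F) =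
    (F.map fun σ =>
      ((cuts σ).map fun c => ((c.1 + 1, c.2.1 + {c.2.2}, 0) : ℕ × Forest × Forest)) +
      ((cuts σ).map fun c => ((c.1, c.2.1, {c.2.2}) : ℕ × Forest × Forest))).Sections.map
    fun s => (s.sum.1, s.sum.2.1, node s.sum.2.2) := by
  rw [cuts, recurse_node, Multiset.map_map]
  rfl

theorem admissibleCuts_node (F : Forest) : admissibleCuts (node F) =
    (F.map fun σ => (({σ}, 0) : Forest × Forest) ::ₘ
        (admissibleCuts σ).map fun c => ((c.1, {c.2}) : Forest × Forest)).Sections.map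
    fun s => (s.sum.1, node s.sum.2) := by
  rw [admissibleCuts, recurse_node, Multiset.map_map]
  rfl

theorem sections_size {f : RTree → Multiset (Forest × Forest)} (F : Forest)
    (hf : ∀ σ ∈ F, ∀ a ∈ f σ, (a.1.map size).sum + (a.2.map size).sum = size σ) :
    ∀ s ∈ (F.map f).Sections,
      (s.sum.1.map size).sum + (s.sum.2.map size).sum = (F.map size).sum := by
  induction F using Multiset.induction with
  | empty => simp
  | cons σ F ih =>
    intro s hs
    rw [Multiset.map_cons, Multiset.sections_cons, Multiset.mem_bind] at hs
    obtain ⟨a, ha, hs⟩ := hs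
    obtain ⟨u, hu, rfl⟩ := Multiset.mem_map.1 hs
    have h1 : (Multiset.map size a.1).sum + (Multiset.map size a.2).sum = size σ :=
      hf σ (Multiset.mem_cons_self _ _) a ha
    have h2 : (Multiset.map size u.sum.1).sum + (Multiset.map size u.sum.2).sum =
        (Multiset.map size F).sum := ih (fun σ' h' => hf σ' (Multiset.mem_cons_of_mem h')) u hu
    rw [Multiset.sum_cons, Prod.fst_add, Prod.snd_add, Multiset.map_add, Multiset.map_add,
      Multiset.sum_add, Multiset.sum_add, Multiset.map_cons, Multiset.sum_cons]
    omega

/-- A cut distributes the nodes of the tree over `P_c` and `R_c`. -/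
theorem size_of_mem_admissibleCuts (τ : RTree) :
    ∀ c ∈ admissibleCuts τ, (c.1.map size).sum + size c.2 = size τ := by
  induction τ using RTree.induction with
  | h F ih =>
    intro c hc
    rw [admissibleCuts_node] at hc
    obtain ⟨s, hs, rfl⟩ := Multiset.mem_map.1 hc
    have h := sections_size F (fun σ hσ a ha => by
      rcases Multiset.mem_cons.1 ha with rfl | ha
      · simp
      · obtain ⟨c, hc, rfl⟩ := Multiset.mem_map.1 ha
        simpa using ih σ hσ c hc) s hs
    simp only [size_node]
    omega

theorem size_lt_of_mem_properCuts {τ : RTree} {c : Forest × RTree} (hc : c ∈ properCuts τ) :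
    (∀ σ ∈ c.1, size σ < size τ) ∧ size c.2 < size τ := by
  classical
  unfold properCuts at hc
  obtain ⟨hc, h0⟩ := Multiset.mem_filter.1 hc
  have h := size_of_mem_admissibleCuts τ c hc
  have h2 := size_pos c.2
  have h3 : ∀ σ ∈ c.1, size σ ≤ (c.1.map size).sum := fun σ hσ =>
    Multiset.single_le_sum (fun _ _ => Nat.zero_le _) _ (Multiset.mem_map_of_mem size hσ)
  obtain ⟨σ, hσ⟩ := Multiset.exists_mem_of_ne_zero h0
  have h4 := h3 σ hσ
  have h5 := size_pos σ
  exact ⟨fun ρ hρ => by have := h3 ρ hρ; omega, by omega⟩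

open scoped Classical in
theorem sections_filter {f : RTree → Multiset (Forest × Forest)} (F : Forest)
    (hf : ∀ σ ∈ F, (f σ).filter (fun a => a.1 = 0) = {(0, {σ})}) :
    ((F.map f).Sections.map Multiset.sum).filter (fun a => a.1 = 0) = {(0, F)} := by
  induction F using Multiset.induction with
  | empty => simp [Multiset.filter_singleton, Prod.ext_iff]
  | cons σ F ih =>
    have h1 := hf σ (Multiset.mem_cons_self _ _)
    have h2 := ih fun σ' h' => hf σ' (Multiset.mem_cons_of_mem h')
    have key : ∀ (U V : Multiset (Forest × Forest)),
        (U.bind fun a => V.map fun v => a + v).filter (fun a => a.1 = 0) =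
          (U.filter fun a => a.1 = 0).bind fun a =>
            (V.filter fun a => a.1 = 0).map fun v => a + v := by
      intro U V
      induction U using Multiset.induction with
      | empty => simp
      | cons a U ihU =>
        rw [Multiset.cons_bind, Multiset.filter_add, ihU, Multiset.filter_map]
        by_cases ha : a.1 = 0
        · rw [Multiset.filter_cons_of_pos (p := fun a : Forest × Forest => a.1 = 0) _ ha, Multiset.cons_bind]
          congr 2
          refine Multiset.filter_congr fun v _ => ?_
          simp [ha]
        · rw [Multiset.filter_cons_of_neg (p := fun a : Forest × Forest => a.1 = 0) _ ha]
          have : V.filter ((fun a => a.1 = 0) ∘ fun v => a + v) = 0 := by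
            rw [Multiset.filter_eq_nil]
            intro v _
            simp [ha]
          rw [this]
          simp
    have h3 : ((σ ::ₘ F).map f).Sections.map Multiset.sum =
        (f σ).bind fun a => ((F.map f).Sections.map Multiset.sum).map fun v => a + v := by
      rw [Multiset.map_cons, Multiset.sections_cons, Multiset.map_bind]
      simp [Multiset.map_map]
    rw [h3, key, h1, h2]
    simp

open scoped Classical in
/-- The empty cut occurs exactly once among the admissible cuts. -/
theorem admissibleCuts_filter (τ : RTree) :
    (admissibleCuts τ).filter (fun c => c.1 = 0) = {(0, τ)} := by
  induction τ using RTree.induction with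
  | h F ih =>
    have h := sections_filter (f := fun σ => (({σ}, 0) : Forest × Forest) ::ₘ
        (admissibleCuts σ).map fun c => ((c.1, {c.2}) : Forest × Forest)) F (fun σ hσ => by
      rw [Multiset.filter_cons_of_neg _ (by simp), Multiset.filter_map]
      have := ih σ hσ
      simp only [Function.comp_def]
      rw [this]
      simp)
    have h' := congrArg (Multiset.map fun a : Forest × Forest => (a.1, node a.2)) h
    rw [Multiset.map_singleton] at h'
    rw [← h', admissibleCuts_node, Multiset.filter_map, Multiset.filter_map, Multiset.map_map]
    rfl

theorem admissibleCuts_eq (τ : RTree) : admissibleCuts τ = (0, τ) ::ₘ properCuts τ := by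
  classical
  have h := Multiset.filter_add_not (fun c : Forest × RTree => c.1 = 0) (admissibleCuts τ)
  rw [admissibleCuts_filter] at h
  rw [← h, Multiset.singleton_add]
  congr 1

end RTree

/-! ## The Butcher–Connes–Kreimer Hopf algebra -/

/-- The free commutative `ℝ`-algebra on the non-empty trees; the empty forest is the unit `1`. -/
abbrev BCK : Type := MvPolynomial RTree ℝ

namespace BCK

/-- A tree as an element of the algebra. -/
noncomputable def tree (τ : RTree) : BCK := MvPolynomial.X τ

/-- A forest as an element of the algebra: the product of its trees. -/
noncomputable def forest (F : Forest) : BCK := (F.map tree).prod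

/-- The reduced coproduct `δ(τ) = ∑_{c ∈ Adm(τ)} P_c(τ) ⊗ R_c(τ)` of a tree. -/
noncomputable def reducedCoproduct (τ : RTree) : BCK ⊗[ℝ] BCK :=
  (τ.properCuts.map fun c => forest c.1 ⊗ₜ[ℝ] tree c.2).sum

/-- The coproduct, `Δ(τ) = τ ⊗ ∅ + ∅ ⊗ τ + δ(τ)` on trees. -/
noncomputable def coproduct : BCK →ₐ[ℝ] BCK ⊗[ℝ] BCK :=
  MvPolynomial.aeval fun τ => tree τ ⊗ₜ[ℝ] 1 + 1 ⊗ₜ[ℝ] tree τ + reducedCoproduct τ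

/-- The convolution product `f g = μ ∘ (f ⊗ g) ∘ Δ` of algebra maps. -/
noncomputable def conv {A : Type} [CommRing A] [Algebra ℝ A] (f g : BCK →ₐ[ℝ] A) : BCK →ₐ[ℝ] A :=
  (Algebra.TensorProduct.lmul' ℝ).comp ((Algebra.TensorProduct.map f g).comp coproduct)

/-- The antipode, `S(τ) = ∑_c (-1)^{|c|+1} τ^c` on trees, the sum being over all cuts `c` of `τ`, where
`τ^c` is the forest that remains when the edges in `c` are removed. -/
noncomputable def antipode : BCK →ₐ[ℝ] BCK :=
  MvPolynomial.aeval fun τ =>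
    (τ.cuts.map fun c => (-1 : BCK) ^ (c.1 + 1) * (forest c.2.1 * tree c.2.2)).sum

/-- The canonical involution `τ ↦ (-1)^{|τ|} τ`. -/
noncomputable def involution : BCK →ₐ[ℝ] BCK :=
  MvPolynomial.aeval fun τ => (-1 : BCK) ^ τ.size * tree τ

/-- `S̄(τ) = (-1)^{|τ|} S(τ)`. -/
noncomputable def antipodeBar : BCK →ₐ[ℝ] BCK := antipode.comp involution

/-- Iterates of the recursion `φ(τ) = ½ (τ - μ ∘ (φ ⊗ φ) ∘ δ(τ))`. -/
noncomputable def sqrtIdAux : ℕ → (BCK →ₐ[ℝ] BCK)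
  | 0 => AlgHom.id ℝ BCK
  | n + 1 => MvPolynomial.aeval fun τ => (1 / 2 : ℝ) • (tree τ -
      Algebra.TensorProduct.lmul' ℝ
        (Algebra.TensorProduct.map (sqrtIdAux n) (sqrtIdAux n) (reducedCoproduct τ)))

/-- The square root `Id^{1/2}` of the identity for the convolution product: the multiplicative map with
`Id^{1/2}(τ) = ½ (τ - μ ∘ (Id^{1/2} ⊗ Id^{1/2}) ∘ δ(τ))` on trees. See `sqrtId_tree` and
`conv_sqrtId_sqrtId`. -/
noncomputable def sqrtId : BCK →ₐ[ℝ] BCK :=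
  MvPolynomial.aeval fun τ => sqrtIdAux τ.size (tree τ)

theorem coproduct_tree (τ : RTree) :
    coproduct (tree τ) = tree τ ⊗ₜ[ℝ] 1 + 1 ⊗ₜ[ℝ] tree τ + reducedCoproduct τ := by
  simp [coproduct, tree]

/-- The coproduct is the sum over the total cut and all other admissible cuts. -/
theorem coproduct_tree_eq_sum (τ : RTree) : coproduct (tree τ) =
    tree τ ⊗ₜ[ℝ] 1 + (τ.admissibleCuts.map fun c => forest c.1 ⊗ₜ[ℝ] tree c.2).sum := by
  rw [coproduct_tree, RTree.admissibleCuts_eq, Multiset.map_cons, Multiset.sum_cons, add_assoc]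
  simp [reducedCoproduct, forest]

theorem sqrtIdAux_stable (n : ℕ) : ∀ (m : ℕ) (τ : RTree), τ.size ≤ n → τ.size ≤ m →
    sqrtIdAux n (tree τ) = sqrtIdAux m (tree τ) := by
  induction n with
  | zero =>
    intro m τ h
    have := τ.size_pos
    omega
  | succ n ih =>
    intro m τ hn hm
    cases m with
    | zero =>
      have := τ.size_pos
      omega
    | succ m =>
      simp only [sqrtIdAux, tree, MvPolynomial.aeval_X]
      congr 3
      simp only [reducedCoproduct, map_multiset_sum, Multiset.map_map]
      congr 1
      refine Multiset.map_congr rfl fun c hc => ?_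
      obtain ⟨h1, h2⟩ := RTree.size_lt_of_mem_properCuts hc
      have hR : sqrtIdAux n (tree c.2) = sqrtIdAux m (tree c.2) := ih m _ (by omega) (by omega)
      have hP : sqrtIdAux n (forest c.1) = sqrtIdAux m (forest c.1) := by
        simp only [forest, map_multiset_prod, Multiset.map_map]
        congr 1
        refine Multiset.map_congr rfl fun σ hσ => ?_
        have := h1 σ hσ
        exact ih m σ (by omega) (by omega)
      simp [hR, hP]

/-- The recursion that characterises `Id^{1/2}`. -/
theorem sqrtId_tree (τ : RTree) : sqrtId (tree τ) = (1 / 2 : ℝ) • (tree τ -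
    Algebra.TensorProduct.lmul' ℝ
      (Algebra.TensorProduct.map sqrtId sqrtId (reducedCoproduct τ))) := by
  obtain ⟨n, hn⟩ : ∃ n, τ.size = n + 1 := ⟨τ.size - 1, by have := τ.size_pos; omega⟩
  have h0 : ∀ σ : RTree, σ.size ≤ n → sqrtIdAux n (tree σ) = sqrtId (tree σ) := by
    intro σ hσ
    have : sqrtId (tree σ) = sqrtIdAux σ.size (tree σ) := by
      simp [sqrtId, tree]
    rw [this]
    exact sqrtIdAux_stable _ _ _ hσ le_rfl
  have h1 : sqrtId (tree τ) = sqrtIdAux (n + 1) (tree τ) := by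
    rw [← hn]
    simp [sqrtId, tree]
  rw [h1]
  simp only [sqrtIdAux]
  rw [tree, MvPolynomial.aeval_X]
  congr 3
  simp only [reducedCoproduct, map_multiset_sum, Multiset.map_map]
  congr 1
  refine Multiset.map_congr rfl fun c hc => ?_
  obtain ⟨h1, h2⟩ := RTree.size_lt_of_mem_properCuts hc
  have hR : sqrtIdAux n (tree c.2) = sqrtId (tree c.2) := h0 _ (by omega)
  have hP : sqrtIdAux n (forest c.1) = sqrtId (forest c.1) := by
    simp only [forest, map_multiset_prod, Multiset.map_map]
    congr 1
    refine Multiset.map_congr rfl fun σ hσ => ?_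
    have := h1 σ hσ
    exact h0 σ (by omega)
  simp [hR, hP]

/-- `Id^{1/2}` is a square root of `Id` for the convolution product. -/
theorem conv_sqrtId_sqrtId : conv sqrtId sqrtId = AlgHom.id ℝ BCK := by
  refine MvPolynomial.algHom_ext fun τ => ?_
  change Algebra.TensorProduct.lmul' ℝ
    (Algebra.TensorProduct.map sqrtId sqrtId (coproduct (tree τ))) = tree τ
  have h := sqrtId_tree τ
  rw [coproduct_tree]
  simp only [map_add, Algebra.TensorProduct.map_tmul, map_one,
    Algebra.TensorProduct.lmul'_apply_tmul, mul_one, one_mul]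
  rw [h, ← two_smul ℝ (_ • (_ - _) : BCK)] 
  simp [smul_smul]

/-- `τ⁻ = μ ∘ (S̄ ⊗ Id) ∘ Δ ∘ Id^{1/2}(τ)`. -/
noncomputable def minus : BCK →ₐ[ℝ] BCK := (conv antipodeBar (AlgHom.id ℝ BCK)).comp sqrtId

/-- `τ⁺ = μ ∘ (Id ⊗ (·)⁻ ∘ S) ∘ Δ(τ)`. -/
noncomputable def plus : BCK →ₐ[ℝ] BCK := conv (AlgHom.id ℝ BCK) (minus.comp antipode)

end BCK

/-- A character of the Hopf algebra. -/
abbrev Character : Type := BCK →ₐ[ℝ] ℝ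

namespace Character

/-- `ord(ψ) = sup {n : ψ(τ) = 1/τ! for all |τ| ≤ n}`. -/
noncomputable def ord (ψ : Character) : ℕ∞ :=
  ⨆ (n : ℕ) (_ : ∀ τ : RTree, τ.size ≤ n → ψ (BCK.tree τ) = 1 / (τ.factorial : ℝ)), (n : ℕ∞)

/-- The antisymmetric order `ord⁺(ψ) = sup {n : ψ(τ⁺) = 0 for all |τ| ≤ n}`, over non-empty `τ`. -/
noncomputable def antisymOrd (ψ : Character) : ℕ∞ :=
  ⨆ (n : ℕ) (_ : ∀ τ : RTree, τ.size ≤ n → ψ (BCK.plus (BCK.tree τ)) = 0), (n : ℕ∞)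

end Character

/-! ## Runge–Kutta schemes -/

/-- An `s`-stage Runge–Kutta scheme, given by its Butcher tableau. -/
@[ext] structure RKScheme (s : ℕ) where
  /-- The Runge–Kutta matrix. -/
  A : Matrix (Fin s) (Fin s) ℝ
  /-- The weights. -/
  b : Fin s → ℝ

namespace RKScheme

variable {s : ℕ}

/-- The scheme is explicit: `A` is strictly lower triangular. -/
def IsExplicit (Ψ : RKScheme s) : Prop := ∀ i j : Fin s, i ≤ j → Ψ.A i j = 0

/-- The derivative weights:
`(ψᵢD)([τ₁, …, τₖ]) = ∏ₗ ψᵢ(τₗ)` with the internal weights `ψᵢ(τ) = ∑ⱼ aᵢⱼ (ψⱼD)(τ)`. -/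
noncomputable def derivativeWeight (Ψ : RKScheme s) : RTree → Fin s → ℝ :=
  RTree.recurse fun B i =>
    (B.map fun q : RTree × (Fin s → ℝ) => ∑ j, Ψ.A i j * q.2 j).prod

/-- The elementary weights `ψ(τ) = ∑ᵢ bᵢ (ψᵢD)(τ)`, as a character. -/
noncomputable def character (Ψ : RKScheme s) : Character :=
  MvPolynomial.aeval fun τ => ∑ i, Ψ.b i * Ψ.derivativeWeight τ i

/-- `Ψ ∈ EES(n, m)`: the scheme is explicit, of order exactly `n` and of antisymmetric order
exactly `m`. -/
def IsEES (Ψ : RKScheme s) (n m : ℕ) : Prop :=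
  Ψ.IsExplicit ∧ Ψ.character.ord = n ∧ Ψ.character.antisymOrd = m

end RKScheme

-- Let `ψ` be the character of the scheme and `m = ψ ∘ (·)⁻`. Then `m` is the convolution square
-- root of `(ψ ∘ S̄) * ψ`, and `ψ ∘ (·)⁺ = ψ * m⁻¹`. Hence `ψ(τ⁺)` vanishes up to order `n` exactly
-- if `ψ` and `ψ ∘ S̄` agree up to order `n` (`plus_eq_zero_iff`). For a Runge–Kutta scheme `ψ ∘ S̄`
-- is the character of the adjoint scheme, with matrix `A* = 1 bᵀ - A` and weights `b`
-- (`character_comp_antipodeBar`). A first disagreement can occur only at an even order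
-- (`AgreeUpTo.succ_of_even`), so antisymmetric order 7 means agreement on trees with at most six
-- nodes and disagreement on some tree with at most eight.
--
-- For four explicit stages put `c = A 1`, `d = A c`, `g = A d`; then `A g = 0`. Seven trees with
-- four or six nodes give necessity (`moments_of_agreeUpTo_six`). The unbranched ones force `p =
-- b·d` to satisfy `p² = p - 1/8`, that is `p = (2 - s)/4` with `s² = 2`, and `b·g = p²`. The others
-- express the remaining moments and the abscissae `c₃`, `c₄` through `s` and `k = a₂₁`. Since `b·g
-- ≠ 0`, the moments can be solved for the entries, which yields the componentwise relations `c² = k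
-- c - 2(k - 1) d` and `c d = c₃ d - (1 + s)(2k - 1) g`.
--
-- These relations (`IsEffectivelySymmetric`) are also sufficient. They hold for the adjoint vectors
-- too, so for both schemes at once every forest with at most five nodes reduces to combinations of
-- nine vectors (`forest_mem_weightFiltration`), on which the two weights are compared directly. The
-- unbranched tree with eight nodes separates the two schemes.
--
-- Finally `s` and `k` determine the scheme (`IsEffectivelySymmetric.eq_of_eq`), and `k` is a Möbius
-- function of `x = b₁`. The excluded values of `x` correspond to `k = ∞`, `1`, `0`, `1/2` and to
-- `c₃ = 0`.

namespace BCK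

-- Grafting, coassociativity and the convolution product.

theorem forest_zero : forest 0 = 1 := by simp [forest]

theorem forest_singleton (τ : RTree) : forest {τ} = tree τ := by simp [forest]

theorem forest_add (F G : Forest) : forest (F + G) = forest F * forest G := by
  simp [forest]

open scoped Classical in
theorem forest_eq_monomial (F : Forest) :
    forest F = MvPolynomial.monomial (Multiset.toFinsupp F) (1 : ℝ) := by
  induction F using Multiset.induction with
  | empty => simp [forest]
  | cons τ F ih =>
    rw [← Multiset.singleton_add, forest_add, ih, forest_singleton, tree, MvPolynomial.X,
      MvPolynomial.monomial_mul, map_add, Multiset.toFinsupp_singleton, one_mul]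

/-- Linear maps on the algebra are determined by their values on forests. -/
theorem linearMap_ext {M : Type*} [AddCommMonoid M] [Module ℝ M] {f g : BCK →ₗ[ℝ] M}
    (h : ∀ F, f (forest F) = g (forest F)) : f = g := by
  classical
  refine (MvPolynomial.basisMonomials RTree ℝ).ext fun m => ?_
  have := h (Finsupp.toMultiset m)
  rw [forest_eq_monomial, Finsupp.toMultiset_toFinsupp] at this
  simpa using this

/-- The grafting operator `B₊`, joining the trees of a forest to a new root. -/
noncomputable def graft : BCK →ₗ[ℝ] BCK :=
  (MvPolynomial.basisMonomials RTree ℝ).constr ℝ fun m => tree (RTree.node (Finsupp.toMultiset m))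

theorem graft_forest (F : Forest) : graft (forest F) = tree (RTree.node F) := by
  classical
  rw [forest_eq_monomial]
  have := (MvPolynomial.basisMonomials RTree ℝ).constr_basis ℝ
    (fun m => tree (RTree.node (Finsupp.toMultiset m))) (Multiset.toFinsupp F)
  rw [MvPolynomial.coe_basisMonomials] at this
  rw [graft, this, Multiset.toFinsupp_toMultiset]

/-- Expanding the product of the coproducts of the trees means choosing, for each tree, the total
cut or another admissible cut. These are the choices that define the admissible cuts of the grafted
tree, which is what makes grafting a cocycle. -/
theorem coproduct_forest (F : Forest) : coproduct (forest F) =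
    ((F.map fun σ => (({σ}, 0) : Forest × Forest) ::ₘ
        σ.admissibleCuts.map fun c => ((c.1, {c.2}) : Forest × Forest)).Sections.map
      fun s => forest s.sum.1 ⊗ₜ[ℝ] forest s.sum.2).sum := by
  have hsum : ∀ s : Multiset (Forest × Forest), forest s.sum.1 ⊗ₜ[ℝ] forest s.sum.2 =
      (s.map fun a => forest a.1 ⊗ₜ[ℝ] forest a.2).prod := by
    intro s
    induction s using Multiset.induction with
    | empty => simp [forest_zero, Algebra.TensorProduct.one_def]
    | cons a s ih => simp [forest_add, ← ih, Algebra.TensorProduct.tmul_mul_tmul]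
  have htree : ∀ σ : RTree, coproduct (tree σ) =
      (((({σ}, 0) : Forest × Forest) ::ₘ
        σ.admissibleCuts.map fun c => ((c.1, {c.2}) : Forest × Forest)).map
          fun a => forest a.1 ⊗ₜ[ℝ] forest a.2).sum := by
    intro σ
    rw [coproduct_tree_eq_sum]
    simp [forest_singleton, forest_zero]
  simp only [hsum]
  rw [forest, map_multiset_prod, Multiset.map_map]
  simp only [Function.comp_def, htree]
  have h := Multiset.prod_map_sum (s := F.map fun σ => (((({σ}, 0) : Forest × Forest) ::ₘ
        σ.admissibleCuts.map fun c => ((c.1, {c.2}) : Forest × Forest)).map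
          fun a => forest a.1 ⊗ₜ[ℝ] forest a.2))
  rw [Multiset.map_map] at h
  rw [Function.comp_def] at h
  rw [h]
  have hs : ∀ G : Multiset (Multiset (Forest × Forest)),
      (G.map (Multiset.map fun a => forest a.1 ⊗ₜ[ℝ] forest a.2)).Sections =
        G.Sections.map (Multiset.map fun a => forest a.1 ⊗ₜ[ℝ] forest a.2) := by
    intro G
    induction G using Multiset.induction with
    | empty => simp
    | cons a G ih => simp [ih, Multiset.map_bind, Multiset.bind_map]
  rw [show (F.map fun σ => (((({σ}, 0) : Forest × Forest) ::ₘ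
        σ.admissibleCuts.map fun c => ((c.1, {c.2}) : Forest × Forest)).map
          fun a => forest a.1 ⊗ₜ[ℝ] forest a.2)) = (F.map fun σ => ((({σ}, 0) : Forest × Forest) ::ₘ
        σ.admissibleCuts.map fun c => ((c.1, {c.2}) : Forest × Forest))).map
          (Multiset.map fun a => forest a.1 ⊗ₜ[ℝ] forest a.2) by rw [Multiset.map_map]; rfl, hs,
    Multiset.map_map]
  rfl

/-- `Δ ∘ B₊ = B₊ ⊗ 1 + (Id ⊗ B₊) ∘ Δ`. -/
theorem coproduct_graft (x : BCK) :
    coproduct (graft x) = graft x ⊗ₜ[ℝ] 1 + graft.lTensor BCK (coproduct x) := by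
  have : coproduct.toLinearMap ∘ₗ graft =
      (TensorProduct.mk ℝ BCK BCK).flip 1 ∘ₗ graft + graft.lTensor BCK ∘ₗ coproduct.toLinearMap := by
    refine linearMap_ext fun F => ?_
    simp only [LinearMap.comp_apply, LinearMap.add_apply, AlgHom.toLinearMap_apply, graft_forest,
      LinearMap.flip_apply, TensorProduct.mk_apply]
    rw [coproduct_tree_eq_sum, coproduct_forest, RTree.admissibleCuts_node, map_multiset_sum,
      Multiset.map_map, Multiset.map_map]
    simp [Function.comp_def, graft_forest]
  exact LinearMap.congr_fun this x

/-- Algebra maps agreeing at `B₊(x)` whenever they agree at the forest `x` coincide. -/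
theorem algHom_ext_graft {A : Type*} [CommRing A] [Algebra ℝ A] {f g : BCK →ₐ[ℝ] A}
    (h : ∀ F, f (forest F) = g (forest F) → f (graft (forest F)) = g (graft (forest F))) :
    f = g := by
  refine MvPolynomial.algHom_ext fun τ => ?_
  change f (tree τ) = g (tree τ)
  induction τ using RTree.induction with
  | h F ih =>
    rw [← graft_forest]
    refine h F ?_
    simp only [forest, map_multiset_prod, Multiset.map_map]
    exact congrArg _ (Multiset.map_congr rfl ih)

/-- By the cocycle identity `coproduct_graft`, both sides at `B₊(x)` are obtained from their values
at `x` by the same rule, so induction on trees applies. -/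
theorem coproduct_coassoc : ((Algebra.TensorProduct.assoc ℝ ℝ ℝ BCK BCK BCK).toAlgHom.comp
      ((Algebra.TensorProduct.map coproduct (.id ℝ BCK)).comp coproduct))
      = (Algebra.TensorProduct.map (.id ℝ BCK) coproduct).comp coproduct := by
  refine algHom_ext_graft (A := BCK ⊗[ℝ] (BCK ⊗[ℝ] BCK)) fun F hF => ?_
  set x := forest F
  have h1 : ∀ y : BCK ⊗[ℝ] BCK,
      Algebra.TensorProduct.assoc ℝ ℝ ℝ BCK BCK BCK
        (Algebra.TensorProduct.map coproduct (.id ℝ BCK) (graft.lTensor BCK y)) =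
      (graft.lTensor BCK).lTensor BCK (Algebra.TensorProduct.assoc ℝ ℝ ℝ BCK BCK BCK
        (Algebra.TensorProduct.map coproduct (.id ℝ BCK) y)) := by
    intro y
    induction y using TensorProduct.induction_on with
    | zero => simp
    | add a b ha hb => simp only [map_add, ha, hb]
    | tmul a b =>
      simp only [LinearMap.lTensor_tmul, Algebra.TensorProduct.map_tmul, AlgHom.id_apply]
      induction coproduct a using TensorProduct.induction_on with
      | zero => simp
      | add a b ha hb => simp only [map_add, TensorProduct.add_tmul, ha, hb]
      | tmul a c => simp
  have h2 : ∀ y : BCK ⊗[ℝ] BCK,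
      Algebra.TensorProduct.map (.id ℝ BCK) coproduct (graft.lTensor BCK y) =
        Algebra.TensorProduct.assoc ℝ ℝ ℝ BCK BCK BCK (graft.lTensor BCK y ⊗ₜ[ℝ] 1) +
        (graft.lTensor BCK).lTensor BCK (Algebra.TensorProduct.map (.id ℝ BCK) coproduct y) := by
    intro y
    induction y using TensorProduct.induction_on with
    | zero => simp
    | add a b ha hb =>
      simp only [map_add, TensorProduct.add_tmul, ha, hb]
      abel
    | tmul a b => simp [coproduct_graft, TensorProduct.tmul_add]
  change Algebra.TensorProduct.assoc ℝ ℝ ℝ BCK BCK BCK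
      (Algebra.TensorProduct.map coproduct (.id ℝ BCK) (coproduct x)) =
    Algebra.TensorProduct.map (.id ℝ BCK) coproduct (coproduct x) at hF
  change Algebra.TensorProduct.assoc ℝ ℝ ℝ BCK BCK BCK
      (Algebra.TensorProduct.map coproduct (.id ℝ BCK) (coproduct (graft x))) =
    Algebra.TensorProduct.map (.id ℝ BCK) coproduct (coproduct (graft x))
  rw [coproduct_graft, map_add, map_add, h1, hF, map_add, h2]
  simp [coproduct_graft, TensorProduct.add_tmul, add_assoc, Algebra.TensorProduct.one_def]

theorem conv_apply {A : Type} [CommRing A] [Algebra ℝ A] (f g : BCK →ₐ[ℝ] A) (x : BCK) :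
    conv f g x = Algebra.TensorProduct.lmul' ℝ (Algebra.TensorProduct.map f g (coproduct x)) :=
  rfl

theorem comp_conv {A B : Type} [CommRing A] [Algebra ℝ A] [CommRing B] [Algebra ℝ B]
    (h : A →ₐ[ℝ] B) (f g : BCK →ₐ[ℝ] A) : h.comp (conv f g) = conv (h.comp f) (h.comp g) := by
  ext τ
  simp only [AlgHom.comp_apply, conv_apply]
  induction coproduct (MvPolynomial.X τ) using TensorProduct.induction_on with
  | zero => simp
  | add a b ha hb => simp only [map_add, ha, hb]
  | tmul a b => simp

theorem conv_assoc {A : Type} [CommRing A] [Algebra ℝ A] (f g h : BCK →ₐ[ℝ] A) :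
    conv (conv f g) h = conv f (conv g h) := by
  let M : BCK ⊗[ℝ] (BCK ⊗[ℝ] BCK) →ₐ[ℝ] A := (Algebra.TensorProduct.lmul' ℝ).comp
    (Algebra.TensorProduct.map f ((Algebra.TensorProduct.lmul' ℝ).comp
      (Algebra.TensorProduct.map g h)))
  ext τ
  have key := congrArg M (AlgHom.congr_fun coproduct_coassoc (MvPolynomial.X τ))
  simp only [AlgHom.comp_apply] at key
  rw [conv_apply, conv_apply]
  refine Eq.trans ?_ (key.trans ?_)
  · induction coproduct (MvPolynomial.X τ) using TensorProduct.induction_on with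
    | zero => simp
    | add a b ha hb => simp only [map_add, ha, hb]
    | tmul a b =>
      simp only [Algebra.TensorProduct.map_tmul, Algebra.TensorProduct.lmul'_apply_tmul, conv_apply,
        AlgHom.id_apply]
      induction coproduct a using TensorProduct.induction_on with
      | zero => simp
      | add a b ha hb => simp only [map_add, TensorProduct.add_tmul, add_mul, ha, hb]
      | tmul a c => simp [M, mul_assoc]
  · induction coproduct (MvPolynomial.X τ) using TensorProduct.induction_on with
    | zero => simp
    | add a b ha hb => simp only [map_add, ha, hb]
    | tmul a b => simp [M, conv_apply]

/-- The counit, vanishing on non-empty trees. -/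
noncomputable def counit : BCK →ₐ[ℝ] ℝ := MvPolynomial.aeval fun _ => 0

theorem counit_tree (τ : RTree) : counit (tree τ) = 0 := by simp [counit, tree]

theorem counit_forest {F : Forest} (h : F ≠ 0) : counit (forest F) = 0 := by
  obtain ⟨τ, hτ⟩ := Multiset.exists_mem_of_ne_zero h
  rw [forest, map_multiset_prod, Multiset.map_map]
  exact Multiset.prod_eq_zero (Multiset.mem_map.2 ⟨τ, hτ, counit_tree τ⟩)

theorem conv_tree {A : Type} [CommRing A] [Algebra ℝ A] (f g : BCK →ₐ[ℝ] A) (τ : RTree) :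
    conv f g (tree τ) = f (tree τ) + g (tree τ) +
      (τ.properCuts.map fun c => f (forest c.1) * g (tree c.2)).sum := by
  rw [conv_apply, coproduct_tree, reducedCoproduct]
  simp [map_multiset_sum, Multiset.map_map, Function.comp_def]

theorem ne_zero_of_mem_properCuts {τ : RTree} {c : Forest × RTree} (hc : c ∈ τ.properCuts) :
    c.1 ≠ 0 := by
  classical
  unfold RTree.properCuts at hc
  exact (Multiset.mem_filter.1 hc).2

theorem counit_conv (f : Character) : conv counit f = f := by
  refine MvPolynomial.algHom_ext fun τ => ?_
  change conv counit f (tree τ) = f (tree τ)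
  rw [conv_tree, counit_tree, zero_add, Multiset.sum_eq_zero, add_zero]
  intro a ha
  obtain ⟨c, hc, rfl⟩ := Multiset.mem_map.1 ha
  rw [counit_forest (ne_zero_of_mem_properCuts hc), zero_mul]

theorem conv_counit (f : Character) : conv f counit = f := by
  refine MvPolynomial.algHom_ext fun τ => ?_
  change conv f counit (tree τ) = f (tree τ)
  rw [conv_tree, counit_tree, add_zero, Multiset.sum_eq_zero, add_zero]
  intro a ha
  obtain ⟨c, hc, rfl⟩ := Multiset.mem_map.1 ha
  rw [counit_tree, mul_zero]

-- The antipode as inverse for convolution.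

/-- The signed sum over all cuts, with the root component kept apart. -/
noncomputable def cutSum (τ : RTree) : BCK ⊗[ℝ] BCK :=
  (τ.cuts.map fun c => (-1 : ℝ) ^ c.1 • forest c.2.1 ⊗ₜ[ℝ] tree c.2.2).sum

theorem antipode_tree (τ : RTree) :
    antipode (tree τ) = -Algebra.TensorProduct.lmul' ℝ (cutSum τ) := by
  rw [antipode, tree, MvPolynomial.aeval_X, cutSum, map_multiset_sum, Multiset.map_map,
    ← Multiset.sum_map_neg', Multiset.map_map]
  congr 1
  refine Multiset.map_congr rfl fun c _ => ?_
  simp [pow_succ, Algebra.smul_def]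

/-- The edge from a branch `σ` to the root is either cut, and the signed cuts of `σ` sum to `S(σ) ⊗
1`, or kept, and the root component of `σ` stays attached. -/
theorem cutSum_node (F : Forest) : cutSum (RTree.node F) =
    graft.lTensor BCK (F.map fun σ => antipode (tree σ) ⊗ₜ[ℝ] 1 + cutSum σ).prod := by
  let T : ℕ × Forest × Forest → BCK ⊗[ℝ] BCK := fun a =>
    (-1 : ℝ) ^ a.1 • forest a.2.1 ⊗ₜ[ℝ] forest a.2.2
  have hsum : ∀ s : Multiset (ℕ × Forest × Forest), T s.sum = (s.map T).prod := by
    intro s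
    induction s using Multiset.induction with
    | empty => simp [T, forest_zero, Algebra.TensorProduct.one_def]
    | cons a s ih =>
      simp only [Multiset.sum_cons, Multiset.map_cons, Multiset.prod_cons, ← ih]
      simp only [T, Prod.fst_add, Prod.snd_add, forest_add, pow_add, smul_mul_smul_comm,
        Algebra.TensorProduct.tmul_mul_tmul]
  let H : RTree → Multiset (ℕ × Forest × Forest) := fun σ =>
    (σ.cuts.map fun c => ((c.1 + 1, c.2.1 + {c.2.2}, 0) : ℕ × Forest × Forest)) +
      (σ.cuts.map fun c => ((c.1, c.2.1, {c.2.2}) : ℕ × Forest × Forest))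
  have htree : ∀ σ : RTree, antipode (tree σ) ⊗ₜ[ℝ] 1 + cutSum σ = ((H σ).map T).sum := by
    intro σ
    simp only [H, T, Multiset.map_add, Multiset.sum_add, Multiset.map_map, Function.comp_def,
      forest_zero, forest_singleton]
    congr 1
    rw [antipode_tree, cutSum, map_multiset_sum, Multiset.map_map, ← Multiset.sum_map_neg']
    change (TensorProduct.mk ℝ BCK BCK).flip 1 _ = _
    rw [map_multiset_sum, Multiset.map_map, Multiset.map_map]
    congr 1
    refine Multiset.map_congr rfl fun c _ => ?_
    simp [pow_succ, forest_add, forest_singleton, TensorProduct.smul_tmul', TensorProduct.neg_tmul]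
  have hs : ∀ G : Multiset (Multiset (ℕ × Forest × Forest)),
      (G.map (Multiset.map T)).Sections = G.Sections.map (Multiset.map T) := by
    intro G
    induction G using Multiset.induction with
    | empty => simp
    | cons a G ih => simp [ih, Multiset.map_bind, Multiset.bind_map]
  have hprod : (F.map fun σ => antipode (tree σ) ⊗ₜ[ℝ] 1 + cutSum σ).prod =
      ((F.map H).Sections.map fun s => T s.sum).sum := by
    simp only [htree, hsum]
    have h := Multiset.prod_map_sum (s := (F.map H).map (Multiset.map T))
    rw [hs, Multiset.map_map, Multiset.map_map, Multiset.map_map] at h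
    exact h
  rw [hprod, cutSum, RTree.cuts_node, Multiset.map_map, map_multiset_sum, Multiset.map_map]
  congr 1
  refine Multiset.map_congr rfl fun s _ => ?_
  simp [T, graft_forest]

/-- An arbitrary cut consists of an admissible cut, formed by its edges closest to the root, and
arbitrary cuts of the pieces split off; the latter are summed by `S`. Multiplying out gives `S(τ) -
S(τ) = 0`, the antipode property. -/
theorem map_antipode_coproduct (τ : RTree) :
    Algebra.TensorProduct.map antipode (.id ℝ BCK) (coproduct (tree τ)) =
      antipode (tree τ) ⊗ₜ[ℝ] 1 + cutSum τ := by
  induction τ using RTree.induction with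
  | h F ih =>
    have h : ∀ y : BCK ⊗[ℝ] BCK,
        Algebra.TensorProduct.map antipode (.id ℝ BCK) (graft.lTensor BCK y) =
          graft.lTensor BCK (Algebra.TensorProduct.map antipode (.id ℝ BCK) y) := by
      intro y
      induction y using TensorProduct.induction_on with
      | zero => simp
      | add a b ha hb => simp only [map_add, ha, hb]
      | tmul a b => simp
    rw [cutSum_node, ← graft_forest, coproduct_graft, map_add, h, Algebra.TensorProduct.map_tmul,
      map_one]
    congr 2
    rw [forest, map_multiset_prod, map_multiset_prod, Multiset.map_map, Multiset.map_map]
    exact congrArg _ (Multiset.map_congr rfl ih)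

/-- The antipode is a left inverse of the identity for the convolution product. -/
theorem conv_antipode_left (f : Character) : conv (f.comp antipode) f = counit := by
  refine MvPolynomial.algHom_ext fun τ => ?_
  change conv (f.comp antipode) f (tree τ) = counit (tree τ)
  have h1 : f.comp (conv antipode (.id ℝ BCK)) = conv (f.comp antipode) f := by
    rw [comp_conv, AlgHom.comp_id]
  rw [counit_tree, ← h1, AlgHom.comp_apply, conv_apply, map_antipode_coproduct, map_add,
    Algebra.TensorProduct.lmul'_apply_tmul, mul_one, antipode_tree, neg_add_cancel, map_zero]

/-- The antipode is a right inverse of the identity for the convolution product. -/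
theorem conv_antipode_right (f : Character) : conv f (f.comp antipode) = counit := by
  have h := conv_antipode_left (f.comp antipode)
  calc conv f (f.comp antipode)
      = conv (conv ((f.comp antipode).comp antipode) (f.comp antipode))
          (conv f (f.comp antipode)) := by rw [h, counit_conv]
    _ = conv ((f.comp antipode).comp antipode) (conv (conv (f.comp antipode) f)
          (f.comp antipode)) := by rw [conv_assoc, conv_assoc]
    _ = counit := by rw [conv_antipode_left, counit_conv, h]

/-- A right inverse for the convolution product is given by the antipode. -/
theorem comp_antipode_eq {f g : Character} (h : conv f g = counit) : f.comp antipode = g := by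
  rw [← conv_counit (f.comp antipode), ← h, ← conv_assoc, conv_antipode_left, counit_conv]

end BCK

-- Agreement of characters and the antisymmetric order.

namespace BCK

/-- Two characters agree on all trees with at most `n` nodes. -/
def AgreeUpTo (n : ℕ) (f g : Character) : Prop :=
  ∀ τ : RTree, τ.size ≤ n → f (tree τ) = g (tree τ)

namespace AgreeUpTo

variable {n : ℕ} {f f' g g' h : Character}

theorem refl (n : ℕ) (f : Character) : AgreeUpTo n f f := fun _ _ => rfl

theorem symm (H : AgreeUpTo n f g) : AgreeUpTo n g f := fun τ hτ => (H τ hτ).symm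

theorem forest (H : AgreeUpTo n f g) {F : Forest} (hF : ∀ σ ∈ F, σ.size ≤ n) :
    f (forest F) = g (forest F) := by
  simp only [BCK.forest, map_multiset_prod, Multiset.map_map]
  exact congrArg _ (Multiset.map_congr rfl fun σ hσ => H σ (hF σ hσ))

/-- A proper cut involves only trees strictly smaller than `τ`, so agreement up to `n` controls the
middle terms even at size `n + 1`. This drives the inductions on the order. -/
theorem sum_properCuts (H : AgreeUpTo n f f') (H' : AgreeUpTo n g g') {τ : RTree}
    (hτ : τ.size ≤ n + 1) :
    (τ.properCuts.map fun c => f (BCK.forest c.1) * g (tree c.2)).sum =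
      (τ.properCuts.map fun c => f' (BCK.forest c.1) * g' (tree c.2)).sum := by
  congr 1
  refine Multiset.map_congr rfl fun c hc => ?_
  obtain ⟨h1, h2⟩ := RTree.size_lt_of_mem_properCuts hc
  rw [H.forest fun σ hσ => by have := h1 σ hσ; omega, H' c.2 (by omega)]

theorem mono {m : ℕ} (hm : m ≤ n) (H : AgreeUpTo n f g) : AgreeUpTo m f g :=
  fun τ hτ => H τ (hτ.trans hm)

theorem conv (H : AgreeUpTo n f f') (H' : AgreeUpTo n g g') :
    AgreeUpTo n (conv f g) (conv f' g') := by
  intro τ hτ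
  rw [conv_tree, conv_tree, H τ hτ, H' τ hτ, sum_properCuts H H' (by omega)]

/-- Square roots for the convolution product are unique. -/
theorem of_conv_self (H : AgreeUpTo n (BCK.conv f f) (BCK.conv g g)) : AgreeUpTo n f g := by
  induction n with
  | zero =>
    intro τ hτ
    have := τ.size_pos
    omega
  | succ n ih =>
    have hn := ih (H.mono n.le_succ)
    intro τ hτ
    have h := H τ hτ
    rw [conv_tree, conv_tree, sum_properCuts hn hn hτ] at h
    -- The hypothesis now reads `2 f(τ) + (sum) = 2 g(τ) + (same sum)`.
    linarith

end AgreeUpTo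

/-- `ψ(τ⁺)` vanishes up to order `n` exactly if `ψ` agrees with `ψ ∘ S̄` up to order `n`. -/
theorem plus_eq_zero_iff (ψ : Character) (n : ℕ) :
    (∀ τ : RTree, τ.size ≤ n → ψ (plus (tree τ)) = 0) ↔
      AgreeUpTo n ψ (ψ.comp antipodeBar) := by
  set χ := ψ.comp antipodeBar with hχ
  set m : Character := ψ.comp minus with hm
  -- Precomposition with `Id^{1/2}` takes convolution square roots.
  have hmm : conv m m = conv χ ψ := by
    have h : m = (conv χ ψ).comp sqrtId := by
      rw [hm, minus, ← AlgHom.comp_assoc, comp_conv, AlgHom.comp_id]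
    rw [h, ← comp_conv, conv_sqrtId_sqrtId, AlgHom.comp_id]
  have hplus : ψ.comp plus = conv ψ (m.comp antipode) := by
    rw [plus, comp_conv, AlgHom.comp_id, hm, AlgHom.comp_assoc]
  have h1 : (∀ τ : RTree, τ.size ≤ n → ψ (plus (tree τ)) = 0) ↔
      AgreeUpTo n (conv ψ (m.comp antipode)) counit := by
    refine forall_congr' fun τ => imp_congr_right fun _ => ?_
    rw [counit_tree, ← hplus, AlgHom.comp_apply]
  rw [h1]
  constructor
  · intro H
    -- From `ψ * m⁻¹ = ε`, convolving with `m` gives `ψ = m`. Squaring gives `ψ * ψ = χ * ψ`, and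
    -- `ψ` cancels on the right.
    have H1 : AgreeUpTo n ψ m := by
      have := H.conv (AgreeUpTo.refl n m)
      rwa [conv_assoc, conv_antipode_left, conv_counit, counit_conv] at this
    have H2 := H1.conv H1
    rw [hmm] at H2
    have := H2.conv (AgreeUpTo.refl n (ψ.comp antipode))
    rwa [conv_assoc, conv_antipode_right, conv_counit, conv_assoc, conv_antipode_right,
      conv_counit] at this
  · intro H
    have H1 : AgreeUpTo n ψ m := by
      refine AgreeUpTo.of_conv_self ?_
      rw [hmm]
      exact H.conv (AgreeUpTo.refl n ψ)
    have := H1.conv (AgreeUpTo.refl n (m.comp antipode))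
    rwa [conv_antipode_right] at this

theorem comp_involution_tree (f : Character) (τ : RTree) :
    f.comp involution (tree τ) = (-1) ^ τ.size * f (tree τ) := by
  simp [involution, tree]

theorem comp_involution_forest (f : Character) (F : Forest) :
    f.comp involution (forest F) = (-1) ^ (F.map RTree.size).sum * f (forest F) := by
  induction F using Multiset.induction with
  | empty => simp [forest_zero]
  | cons τ F ih =>
    rw [← Multiset.singleton_add, forest_add, map_mul, ih, map_mul, forest_singleton,
      comp_involution_tree]
    simp only [Multiset.map_add, Multiset.map_singleton, Multiset.sum_add, Multiset.sum_singleton,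
      pow_add]
    ring

/-- The coproduct is graded: the nodes of `P_c` and `R_c` add up to those of `τ`, so the signs
multiply. -/
theorem conv_comp_involution (f g : Character) :
    (conv f g).comp involution = conv (f.comp involution) (g.comp involution) := by
  refine MvPolynomial.algHom_ext fun τ => ?_
  change (conv f g).comp involution (tree τ) =
    conv (f.comp involution) (g.comp involution) (tree τ)
  rw [comp_involution_tree, conv_tree, conv_tree, comp_involution_tree, comp_involution_tree,
    mul_add, mul_add, ← Multiset.sum_map_mul_left]
  congr 2
  refine Multiset.map_congr rfl fun c hc => ?_
  have h : c ∈ τ.admissibleCuts := by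
    rw [RTree.admissibleCuts_eq]
    exact Multiset.mem_cons_of_mem hc
  rw [comp_involution_forest, comp_involution_tree, ← RTree.size_of_mem_admissibleCuts τ c h,
    pow_add]
  ring

theorem counit_comp_involution : counit.comp involution = counit := by
  refine MvPolynomial.algHom_ext fun τ => ?_
  change counit.comp involution (tree τ) = counit (tree τ)
  rw [comp_involution_tree, counit_tree, mul_zero]

theorem AgreeUpTo.comp_involution {n : ℕ} {f g : Character} (H : AgreeUpTo n f g) :
    AgreeUpTo n (f.comp involution) (g.comp involution) := by
  intro τ hτ
  rw [comp_involution_tree, comp_involution_tree, H τ hτ]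

/-- The first order at which `ψ` and `ψ ∘ S̄` disagree is even. -/
theorem AgreeUpTo.succ_of_even {n : ℕ} {ψ : Character} (hn : Even n)
    (H : AgreeUpTo n ψ (ψ.comp antipodeBar)) : AgreeUpTo (n + 1) ψ (ψ.comp antipodeBar) := by
  intro τ hτ
  rcases hτ.lt_or_eq with hlt | heq
  · exact H τ (by omega)
  set χ := ψ.comp antipodeBar with hχ
  have hS : χ = (ψ.comp antipode).comp involution := by
    rw [hχ, antipodeBar, AlgHom.comp_assoc]
  have hinv : (involution : BCK →ₐ[ℝ] BCK).comp involution = AlgHom.id ℝ BCK := by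
    refine MvPolynomial.algHom_ext fun τ => ?_
    simp [involution, tree, ← mul_assoc, ← pow_add, ← two_mul]
  have h1 : BCK.conv ψ (χ.comp involution) = counit := by
    rw [hS, AlgHom.comp_assoc, hinv, AlgHom.comp_id, conv_antipode_right]
  have h2 : BCK.conv χ (ψ.comp involution) = counit := by
    rw [hS, ← conv_comp_involution, conv_antipode_left, counit_comp_involution]
  have e1 := AlgHom.congr_fun h1 (tree τ)
  have e2 := AlgHom.congr_fun h2 (tree τ)
  -- At an odd size the two inverse relations contain `ψ(τ) - χ(τ)` and `χ(τ) - ψ(τ)` with the same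
  -- lower terms; subtracting them leaves `ψ(τ) = χ(τ)`.
  rw [conv_tree, counit_tree, comp_involution_tree, heq, hn.add_one.neg_one_pow] at e1 e2
  rw [H.sum_properCuts H.symm.comp_involution hτ] at e1
  linarith

theorem conv_graft {ι : Type*} [Fintype ι] (f g : Character) (β : ι → ℝ) (h : ι → Character)
    (hg : ∀ x, g (graft x) = ∑ i, β i * h i x) (x : BCK) :
    conv f g (graft x) = f (graft x) + ∑ i, β i * conv f (h i) x := by
  rw [conv_apply, coproduct_graft]
  simp only [conv_apply, map_add, Algebra.TensorProduct.map_tmul, map_one,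
    Algebra.TensorProduct.lmul'_apply_tmul, mul_one]
  congr 1
  induction coproduct x using TensorProduct.induction_on with
  | zero => simp
  | add a b ha hb => simp only [map_add, ha, hb, mul_add, Finset.sum_add_distrib]
  | tmul a b =>
    simp only [LinearMap.lTensor_tmul, Algebra.TensorProduct.map_tmul,
      Algebra.TensorProduct.lmul'_apply_tmul, hg, Finset.mul_sum]
    exact Finset.sum_congr rfl fun i _ => by ring

end BCK

-- Weights of Runge–Kutta schemes and the adjoint scheme.

open BCK

namespace RKScheme

variable {s : ℕ}

/-- The internal weights `ψᵢ(τ) = ∑ⱼ aᵢⱼ (ψⱼD)(τ)`, as characters. -/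
noncomputable def stage (Ψ : RKScheme s) (i : Fin s) : Character :=
  MvPolynomial.aeval fun τ => ∑ j, Ψ.A i j * Ψ.derivativeWeight τ j

theorem derivativeWeight_node (Ψ : RKScheme s) (F : Forest) (i : Fin s) :
    Ψ.derivativeWeight (RTree.node F) i = Ψ.stage i (forest F) := by
  rw [derivativeWeight, RTree.recurse_node, forest, map_multiset_prod, Multiset.map_map,
    Multiset.map_map]
  simp [stage, tree, derivativeWeight, Function.comp_def]

theorem stage_graft (Ψ : RKScheme s) (i : Fin s) (x : BCK) :
    Ψ.stage i (graft x) = ∑ j, Ψ.A i j * Ψ.stage j x := by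
  have : (Ψ.stage i).toLinearMap ∘ₗ graft = ∑ j, Ψ.A i j • (Ψ.stage j).toLinearMap := by
    refine linearMap_ext fun F => ?_
    simp only [LinearMap.comp_apply, graft_forest, LinearMap.sum_apply, LinearMap.smul_apply,
      AlgHom.toLinearMap_apply, ← derivativeWeight_node, smul_eq_mul]
    simp [stage, tree]
  simpa using LinearMap.congr_fun this x

theorem character_graft (Ψ : RKScheme s) (x : BCK) :
    Ψ.character (graft x) = ∑ j, Ψ.b j * Ψ.stage j x := by
  have : Ψ.character.toLinearMap ∘ₗ graft = ∑ j, Ψ.b j • (Ψ.stage j).toLinearMap := by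
    refine linearMap_ext fun F => ?_
    simp only [LinearMap.comp_apply, graft_forest, LinearMap.sum_apply, LinearMap.smul_apply,
      AlgHom.toLinearMap_apply, ← derivativeWeight_node, smul_eq_mul]
    simp [character, tree]
  simpa using LinearMap.congr_fun this x

/-- The scheme of a backward step, with all coefficients negated. -/
def negate (Ψ : RKScheme s) : RKScheme s := ⟨-Ψ.A, -Ψ.b⟩

/-- The scheme whose character is the inverse for the convolution product. -/
def inverse (Ψ : RKScheme s) : RKScheme s := ⟨fun i j => Ψ.A i j - Ψ.b j, -Ψ.b⟩

/-- The adjoint scheme. -/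
def adjoint (Ψ : RKScheme s) : RKScheme s := ⟨fun i j => Ψ.b j - Ψ.A i j, Ψ.b⟩

theorem negate_inverse (Ψ : RKScheme s) : Ψ.inverse.negate = Ψ.adjoint := by
  refine RKScheme.ext (funext fun i => funext fun j => ?_) (neg_neg _)
  exact neg_sub _ _

theorem algHom_forest_congr {f g : Character} {F : Forest}
    (h : ∀ τ ∈ F, f (tree τ) = g (tree τ)) : f (forest F) = g (forest F) := by
  simp only [forest, map_multiset_prod, Multiset.map_map]
  exact congrArg _ (Multiset.map_congr rfl h)

theorem involution_graft_forest (F : Forest) :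
    involution (graft (forest F)) = -graft (involution (forest F)) := by
  have h : ∀ F : Forest, involution (forest F) =
      ((-1 : ℝ) ^ (F.map RTree.size).sum) • forest F := by
    intro F
    induction F using Multiset.induction with
    | empty => simp [forest_zero]
    | cons τ F ih =>
      rw [← Multiset.singleton_add, forest_add, map_mul, ih, forest_singleton]
      simp [involution, tree, pow_add, Algebra.smul_def]
      ring
  rw [h, map_smul, graft_forest, ← forest_singleton, h]
  simp [RTree.size_node, pow_add]

theorem stage_negate (Ψ : RKScheme s) (i : Fin s) :
    Ψ.negate.stage i = (Ψ.stage i).comp involution := by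
  refine MvPolynomial.algHom_ext fun τ => ?_
  change Ψ.negate.stage i (tree τ) = (Ψ.stage i).comp involution (tree τ)
  induction τ using RTree.induction generalizing i with
  | h F ih =>
    rw [← graft_forest, stage_graft, AlgHom.comp_apply, involution_graft_forest, map_neg,
      stage_graft, ← Finset.sum_neg_distrib]
    refine Finset.sum_congr rfl fun j _ => ?_
    rw [algHom_forest_congr fun τ hτ => ih τ hτ j, AlgHom.comp_apply]
    simp [negate]

theorem character_negate (Ψ : RKScheme s) :
    Ψ.negate.character = Ψ.character.comp involution := by
  refine algHom_ext_graft fun F _ => ?_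
  rw [character_graft, AlgHom.comp_apply, involution_graft_forest, map_neg, character_graft,
    ← Finset.sum_neg_distrib]
  refine Finset.sum_congr rfl fun j _ => ?_
  rw [stage_negate, AlgHom.comp_apply]
  simp [negate]

/-- The inverse scheme, started from the output of `Ψ`, runs through the same stages as `Ψ`: in the
recursion the terms `bⱼ` contributed by the step cancel those subtracted in `aᵢⱼ - bⱼ`. -/
theorem conv_stage_inverse (Ψ : RKScheme s) (i : Fin s) :
    conv Ψ.character (Ψ.inverse.stage i) = Ψ.stage i := by
  refine MvPolynomial.algHom_ext fun τ => ?_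
  change conv Ψ.character (Ψ.inverse.stage i) (tree τ) = Ψ.stage i (tree τ)
  induction τ using RTree.induction generalizing i with
  | h F ih =>
    rw [← graft_forest, conv_graft _ _ _ _ (Ψ.inverse.stage_graft i), character_graft, stage_graft,
      ← Finset.sum_add_distrib]
    refine Finset.sum_congr rfl fun j _ => ?_
    rw [algHom_forest_congr fun τ hτ => ih τ hτ j]
    simp only [inverse]
    ring

theorem conv_character_inverse (Ψ : RKScheme s) :
    conv Ψ.character Ψ.inverse.character = counit := by
  refine algHom_ext_graft fun F _ => ?_
  rw [conv_graft _ _ _ _ Ψ.inverse.character_graft, character_graft, ← Finset.sum_add_distrib,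
    graft_forest, counit_tree]
  refine Finset.sum_eq_zero fun j _ => ?_
  rw [conv_stage_inverse]
  simp [inverse]

theorem character_comp_antipodeBar (Ψ : RKScheme s) :
    Ψ.character.comp antipodeBar = Ψ.adjoint.character := by
  rw [antipodeBar, ← AlgHom.comp_assoc, comp_antipode_eq Ψ.conv_character_inverse,
    ← character_negate, negate_inverse]

end RKScheme

-- Membership in EES(2,7) as agreement with the adjoint.

theorem iSup_natCast_eq_iff {p : ℕ → Prop} (hp : ∀ m n, m ≤ n → p n → p m) {m : ℕ} (hm : 0 < m) :
    (⨆ (n : ℕ) (_ : p n), (n : ℕ∞)) = m ↔ p m ∧ ¬ p (m + 1) := by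
  constructor
  · intro h
    have hle : ∀ n, p n → n ≤ m := fun n hn => by
      have : (n : ℕ∞) ≤ m := h ▸ le_iSup₂ (f := fun (n : ℕ) (_ : p n) => (n : ℕ∞)) n hn
      exact_mod_cast this
    refine ⟨by_contra fun hpm => ?_, fun h1 => by have := hle _ h1; omega⟩
    -- Positivity of `m` matters here: the supremum is also `0` when no `n` satisfies `p`.
    have : (m : ℕ∞) ≤ (m - 1 : ℕ) := h ▸ iSup₂_le fun n hn => by
      have h1 := hle n hn
      have h2 : n ≠ m := fun e => hpm (e ▸ hn)
      exact_mod_cast (by omega : n ≤ m - 1)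
    have : m ≤ m - 1 := by exact_mod_cast this
    omega
  · rintro ⟨h1, h2⟩
    refine le_antisymm (iSup₂_le fun n hn => ?_)
      (le_iSup₂ (f := fun (n : ℕ) (_ : p n) => (n : ℕ∞)) m h1)
    have : n ≤ m := by
      by_contra h
      exact h2 (hp _ _ (by omega) hn)
    exact_mod_cast this

namespace Character

theorem ord_eq_iff (ψ : Character) {m : ℕ} (hm : 0 < m) : ψ.ord = m ↔
    (∀ τ : RTree, τ.size ≤ m → ψ (tree τ) = 1 / (τ.factorial : ℝ)) ∧
    ¬ ∀ τ : RTree, τ.size ≤ m + 1 → ψ (tree τ) = 1 / (τ.factorial : ℝ) :=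
  iSup_natCast_eq_iff (fun _ _ hmn h τ hτ => h τ (hτ.trans hmn)) hm

theorem antisymOrd_eq_iff (ψ : Character) {m : ℕ} (hm : 0 < m) : ψ.antisymOrd = m ↔
    AgreeUpTo m ψ (ψ.comp antipodeBar) ∧ ¬ AgreeUpTo (m + 1) ψ (ψ.comp antipodeBar) := by
  rw [← plus_eq_zero_iff, ← plus_eq_zero_iff]
  exact iSup_natCast_eq_iff (fun _ _ hmn h τ hτ => h τ (hτ.trans hmn)) hm

end Character

namespace RTree

theorem size_eq_one_iff {τ : RTree} : τ.size = 1 ↔ τ = node 0 := by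
  constructor
  · intro h
    obtain ⟨F, rfl⟩ := exists_eq_node τ
    rcases eq_or_ne F 0 with rfl | hF
    · rfl
    · obtain ⟨σ, hσ⟩ := Multiset.exists_mem_of_ne_zero hF
      have h1 := size_lt_of_mem hσ
      have h2 := size_pos σ
      omega
  · rintro rfl
    simp [size_node]

theorem eq_of_size_eq_two {τ : RTree} (h : τ.size = 2) : τ = node {node 0} := by
  obtain ⟨F, rfl⟩ := exists_eq_node τ
  rw [size_node] at h
  induction F using Multiset.induction with
  | empty => simp at h
  | cons σ F _ =>
    rcases eq_or_ne F 0 with rfl | hF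
    · have : σ.size = 1 := by simpa [add_comm 1] using h
      rw [size_eq_one_iff.1 this]
      rfl
    · obtain ⟨ρ, hρ⟩ := Multiset.exists_mem_of_ne_zero hF
      have h1 := size_pos σ
      have h2 := size_pos ρ
      have h3 := Multiset.single_le_sum (s := F.map size) (fun _ _ => Nat.zero_le _) _
        (Multiset.mem_map_of_mem size hρ)
      rw [Multiset.map_cons, Multiset.sum_cons] at h
      omega

theorem factorial_node (F : Forest) :
    factorial (node F) = size (node F) * (F.map factorial).prod := by
  rw [size_node]
  conv_lhs => rw [factorial, recurse_node]
  simp only [Multiset.map_map, Function.comp_def]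
  rfl

end RTree

/-- If the values of an algebra map at grafted trees are given by a linear map `Λ`, its values at
forests respect any filtration that is compatible with products and with `Λ` up to degree `N`. -/
theorem BCK.forest_mem_filtration {R : Type*} [CommRing R] [Algebra ℝ R] (U : BCK →ₐ[ℝ] R)
    (Λ : R →ₗ[ℝ] R) (hU : ∀ x, U (graft x) = Λ (U x)) (Fil : ℕ → Submodule ℝ R) (N : ℕ)
    (h1 : Λ 1 ∈ Fil 1)
    (hmul : ∀ i j, 0 < i → 0 < j → i + j ≤ N → ∀ a ∈ Fil i, ∀ b ∈ Fil j, a * b ∈ Fil (i + j))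
    (hΛ : ∀ i, 0 < i → i + 1 ≤ N → ∀ a ∈ Fil i, Λ a ∈ Fil (i + 1)) :
    ∀ F : Forest, F ≠ 0 → (F.map RTree.size).sum ≤ N →
      U (forest F) ∈ Fil (F.map RTree.size).sum := by
  have hpos : ∀ F : Forest, F ≠ 0 → 0 < (F.map RTree.size).sum := fun F hF => by
    obtain ⟨ρ, hρ⟩ := Multiset.exists_mem_of_ne_zero hF
    have h2 := RTree.size_pos ρ
    have h3 := Multiset.single_le_sum (s := F.map RTree.size) (fun _ _ => Nat.zero_le _) _
      (Multiset.mem_map_of_mem RTree.size hρ)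
    omega
  have key : ∀ F : Forest, (∀ σ ∈ F, σ.size ≤ N → U (tree σ) ∈ Fil σ.size) → F ≠ 0 →
      (F.map RTree.size).sum ≤ N → U (forest F) ∈ Fil (F.map RTree.size).sum := by
    intro F
    induction F using Multiset.induction with
    | empty => simp
    | cons σ F ih =>
      intro hσ _ hN
      rw [Multiset.map_cons, Multiset.sum_cons] at hN ⊢
      rw [← Multiset.singleton_add, forest_add, forest_singleton, map_mul]
      have h2 := hσ σ (Multiset.mem_cons_self _ _) (by omega)
      rcases eq_or_ne F 0 with rfl | hF
      · simpa [forest_zero] using h2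
      · exact hmul _ _ σ.size_pos (hpos F hF) hN _ h2 _
          (ih (fun ρ hρ => hσ ρ (Multiset.mem_cons_of_mem hρ)) hF (by omega))
  have htree : ∀ τ : RTree, τ.size ≤ N → U (tree τ) ∈ Fil τ.size := by
    intro τ
    induction τ using RTree.induction with
    | h F ih =>
      intro hN
      rw [← graft_forest, hU, RTree.size_node]
      rw [RTree.size_node] at hN
      rcases eq_or_ne F 0 with rfl | hF
      · simpa [forest_zero] using h1
      · rw [add_comm]
        exact hΛ _ (hpos F hF) (by omega) _ (key F ih hF (by omega))
  exact fun F => key F fun σ _ => htree σ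

namespace RKScheme

variable {s : ℕ}

/-- The vector of internal weights. -/
noncomputable def stages (Ψ : RKScheme s) : BCK →ₐ[ℝ] (Fin s → ℝ) :=
  AlgHom.pi Ψ.stage

theorem stages_graft (Ψ : RKScheme s) (x : BCK) :
    Ψ.stages (graft x) = Ψ.A.mulVecLin (Ψ.stages x) :=
  funext fun i => Ψ.stage_graft i x

theorem stages_node (Ψ : RKScheme s) (F : Forest) :
    Ψ.stages (tree (RTree.node F)) = Ψ.A.mulVecLin (Ψ.stages (forest F)) := by
  rw [← graft_forest, stages_graft]

/-- The weights as a linear functional. -/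
def weight (Ψ : RKScheme s) : (Fin s → ℝ) →ₗ[ℝ] ℝ := dotProductBilin ℝ ℝ Ψ.b

theorem weight_apply (Ψ : RKScheme s) (v : Fin s → ℝ) : Ψ.weight v = ∑ i, Ψ.b i * v i := rfl

theorem character_node (Ψ : RKScheme s) (F : Forest) :
    Ψ.character (tree (RTree.node F)) = Ψ.weight (Ψ.stages (forest F)) := by
  rw [← graft_forest, character_graft]
  rfl

theorem adjoint_mulVecLin (Ψ : RKScheme s) (v : Fin s → ℝ) :
    Ψ.adjoint.A.mulVecLin v = Ψ.weight v • (1 : Fin s → ℝ) - Ψ.A.mulVecLin v := by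
  ext i
  change ∑ j, (Ψ.b j - Ψ.A i j) * v j = (∑ j, Ψ.b j * v j) * 1 - ∑ j, Ψ.A i j * v j
  simp only [sub_mul, Finset.sum_sub_distrib, mul_one]

/-- Order two concerns only the two trees with one and two nodes, and by parity agreement up to
seven nodes is the same as agreement up to six. -/
theorem isEES_two_seven_iff (Ψ : RKScheme s) : Ψ.IsEES 2 7 ↔ Ψ.IsExplicit ∧
    (Ψ.weight 1 = 1 ∧ Ψ.weight (Ψ.A.mulVecLin 1) = 1 / 2 ∧
    ¬ ∀ τ : RTree, τ.size ≤ 3 → Ψ.character (tree τ) = 1 / (τ.factorial : ℝ)) ∧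
    AgreeUpTo 6 Ψ.character Ψ.adjoint.character ∧
    ¬ AgreeUpTo 8 Ψ.character Ψ.adjoint.character := by
  have h7 : AgreeUpTo 7 Ψ.character Ψ.adjoint.character ↔
      AgreeUpTo 6 Ψ.character Ψ.adjoint.character := by
    rw [← character_comp_antipodeBar]
    exact ⟨fun h => h.mono (by norm_num), fun h => h.succ_of_even (by decide)⟩
  have e1 : Ψ.character (tree (RTree.node 0)) = Ψ.weight 1 := by
    rw [character_node, forest_zero, map_one]
  have e2 : Ψ.character (tree (RTree.node {RTree.node 0})) = Ψ.weight (Ψ.A.mulVecLin 1) := by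
    rw [character_node, forest_singleton, stages_node, forest_zero, map_one]
  have f1 : RTree.factorial (RTree.node 0) = 1 := by simp [RTree.factorial_node, RTree.size_node]
  have f2 : RTree.factorial (RTree.node {RTree.node 0}) = 2 := by
    simp [RTree.factorial_node, RTree.size_node]
  have h2 : (∀ τ : RTree, τ.size ≤ 2 → Ψ.character (tree τ) = 1 / (τ.factorial : ℝ)) ↔
      Ψ.weight 1 = 1 ∧ Ψ.weight (Ψ.A.mulVecLin 1) = 1 / 2 := by
    constructor
    · intro h
      have g1 := h (RTree.node 0) (by simp [RTree.size_node])
      have g2 := h (RTree.node {RTree.node 0}) (by simp [RTree.size_node])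
      rw [e1, f1] at g1
      rw [e2, f2] at g2
      exact ⟨by simpa using g1, by simpa using g2⟩
    · rintro ⟨g1, g2⟩ τ hτ
      have := τ.size_pos
      obtain h | h : τ.size = 1 ∨ τ.size = 2 := by omega
      · rw [RTree.size_eq_one_iff.1 h, e1, f1, g1]
        simp
      · rw [RTree.eq_of_size_eq_two h, e2, f2, g2]
        simp
  unfold IsEES
  rw [Character.ord_eq_iff _ (by norm_num), Character.antisymOrd_eq_iff _ (by norm_num), h2,
    character_comp_antipodeBar, h7]
  simp only [and_assoc, Nat.reduceAdd]

end RKScheme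

-- A filtration that reduces all small forests to nine generators.

theorem Submodule.mul_mem_of_mem_span {R : Type*} [CommRing R] [Algebra ℝ R] {S T : Set R}
    {P : Submodule ℝ R} (h : ∀ x ∈ S, ∀ y ∈ T, x * y ∈ P) {a b : R} (ha : a ∈ span ℝ S)
    (hb : b ∈ span ℝ T) : a * b ∈ P := by
  have h1 := Submodule.mul_mem_mul ha hb
  rw [Submodule.span_mul_span] at h1
  refine Submodule.span_le.2 ?_ h1
  rintro _ ⟨x, hx, y, hy, rfl⟩
  exact h x hx y hy

theorem Submodule.map_mem_of_mem_span {R : Type*} [AddCommGroup R] [Module ℝ R] {S : Set R}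
    {P : Submodule ℝ R} (Λ : R →ₗ[ℝ] R) (h : ∀ x ∈ S, Λ x ∈ P) {a : R} (ha : a ∈ span ℝ S) :
    Λ a ∈ P :=
  (Submodule.span_le (p := P.comap Λ)).2 h ha

/-- A filtration by finite-dimensional spaces that contains all weights of trees with at most six
nodes, for schemes with `c² = k c + μ d` and `c d = κ d + ρ g`. -/
def weightFiltration {R : Type*} [CommRing R] [Algebra ℝ R] (Λ : R →ₗ[ℝ] R) (c d g h : R) :
    ℕ → Submodule ℝ R
  | 0 => ⊥
  | 1 => .span ℝ {c}
  | 2 => .span ℝ {c, d}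
  | 3 => .span ℝ {c, d, g}
  | 4 => .span ℝ {c, d, g, h, c * g}
  | _ => .span ℝ {c, d, g, h, c * g, Λ h, Λ (c * g), c * h, c * (c * g)}

/-- The two relations eliminate every product of degree at most five except `c g`, `c h` and `c (c
g)`. It is stated over a general ring so that it can be applied to a scheme and its adjoint
simultaneously. -/
theorem forest_mem_weightFiltration {R : Type*} [CommRing R] [Algebra ℝ R] (U : BCK →ₐ[ℝ] R)
    (Λ : R →ₗ[ℝ] R) (hU : ∀ x, U (graft x) = Λ (U x)) {c d g h : R} {k μ κ ρ : ℝ} (hμ : μ ≠ 0)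
    (h1 : Λ 1 = c) (hc : Λ c = d) (hd : Λ d = g) (hg : Λ g = h)
    (hcc : c * c = k • c + μ • d) (hcd : c * d = κ • d + ρ • g) (F : Forest) (hF : F ≠ 0)
    (hF5 : (F.map RTree.size).sum ≤ 5) :
    U (forest F) ∈ weightFiltration Λ c d g h (F.map RTree.size).sum := by
  have m5 : ∀ x ∈ ({c, d, g, h, c * g, Λ h, Λ (c * g), c * h, c * (c * g)} : Set R),
      x ∈ weightFiltration Λ c d g h 5 := fun x hx => Submodule.subset_span hx
  have m4 : ∀ x ∈ ({c, d, g, h, c * g} : Set R), x ∈ weightFiltration Λ c d g h 4 :=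
    fun x hx => Submodule.subset_span hx
  have m3 : ∀ x ∈ ({c, d, g} : Set R), x ∈ weightFiltration Λ c d g h 3 :=
    fun x hx => Submodule.subset_span hx
  have m2 : ∀ x ∈ ({c, d} : Set R), x ∈ weightFiltration Λ c d g h 2 :=
    fun x hx => Submodule.subset_span hx
  simp only [Set.mem_insert_iff, Set.mem_singleton_iff, forall_eq_or_imp, forall_eq] at m5 m4 m3 m2
  obtain ⟨c5, d5, g5, h5, cg5, lh5, lcg5, ch5, ccg5⟩ := m5
  obtain ⟨c4, d4, g4, h4, cg4⟩ := m4
  obtain ⟨c3, d3, g3⟩ := m3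
  obtain ⟨c2, d2⟩ := m2
  -- Computing `c (c d)` in two ways, through `c d` and through `c c`, gives `μ d² = (κ - k) c d + ρ
  -- c g`.
  have hdd : d * d = μ⁻¹ • ((κ - k) • (κ • d + ρ • g) + ρ • (c * g)) := by
    have : μ • (d * d) = (κ - k) • (κ • d + ρ • g) + ρ • (c * g) := by
      rw [← hcd]
      have e1 : c * (c * d) = κ • (c * d) + ρ • (c * g) := by
        conv_lhs => rw [hcd, mul_add, mul_smul_comm, mul_smul_comm]
      have e2 : c * (c * d) = k • (c * d) + μ • (d * d) := by
        rw [← mul_assoc, hcc]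
        simp [add_mul]
      rw [e1] at e2
      rw [sub_smul]
      linear_combination -e2
    rw [← this, smul_smul, inv_mul_cancel₀ hμ, one_smul]
  have hdg : d * g = μ⁻¹ • (c * (c * g) - k • (c * g)) := by
    have : μ • (d * g) = c * (c * g) - k • (c * g) := by
      rw [← mul_assoc, hcc]
      simp [add_mul]
    rw [← this, smul_smul, inv_mul_cancel₀ hμ, one_smul]
  have dd4 : d * d ∈ weightFiltration Λ c d g h 4 := by
    rw [hdd]
    exact Submodule.smul_mem _ _ (add_mem (Submodule.smul_mem _ _ (add_mem
      (Submodule.smul_mem _ _ d4) (Submodule.smul_mem _ _ g4))) (Submodule.smul_mem _ _ cg4))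
  have dd5 : d * d ∈ weightFiltration Λ c d g h 5 := by
    rw [hdd]
    exact Submodule.smul_mem _ _ (add_mem (Submodule.smul_mem _ _ (add_mem
      (Submodule.smul_mem _ _ d5) (Submodule.smul_mem _ _ g5))) (Submodule.smul_mem _ _ cg5))
  have dg5 : d * g ∈ weightFiltration Λ c d g h 5 := by
    rw [hdg]
    exact Submodule.smul_mem _ _ (sub_mem ccg5 (Submodule.smul_mem _ _ cg5))
  have comb : ∀ (P : Submodule ℝ R) (x y : R) (a b : ℝ), x ∈ P → y ∈ P → a • x + b • y ∈ P :=
    fun P x y a b hx hy => add_mem (P.smul_mem a hx) (P.smul_mem b hy)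
  have cc2 : c * c ∈ weightFiltration Λ c d g h 2 := hcc ▸ comb _ _ _ _ _ c2 d2
  have cc3 : c * c ∈ weightFiltration Λ c d g h 3 := hcc ▸ comb _ _ _ _ _ c3 d3
  have cc4 : c * c ∈ weightFiltration Λ c d g h 4 := hcc ▸ comb _ _ _ _ _ c4 d4
  have cc5 : c * c ∈ weightFiltration Λ c d g h 5 := hcc ▸ comb _ _ _ _ _ c5 d5
  have cd3 : c * d ∈ weightFiltration Λ c d g h 3 := hcd ▸ comb _ _ _ _ _ d3 g3
  have cd4 : c * d ∈ weightFiltration Λ c d g h 4 := hcd ▸ comb _ _ _ _ _ d4 g4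
  have cd5 : c * d ∈ weightFiltration Λ c d g h 5 := hcd ▸ comb _ _ _ _ _ d5 g5
  refine forest_mem_filtration U Λ hU (weightFiltration Λ c d g h) 5 ?_ ?_ ?_ F hF hF5
  · rw [h1]
    exact Submodule.subset_span rfl
  · have key : ∀ i j, 0 < i → i ≤ j → i + j ≤ 5 → ∀ a ∈ weightFiltration Λ c d g h i,
        ∀ b ∈ weightFiltration Λ c d g h j, a * b ∈ weightFiltration Λ c d g h (i + j) := by
      intro i j hi hij hN a ha b hb
      obtain ⟨rfl, rfl⟩ | ⟨rfl, rfl⟩ | ⟨rfl, rfl⟩ | ⟨rfl, rfl⟩ | ⟨rfl, rfl⟩ | ⟨rfl, rfl⟩ :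
          (i = 1 ∧ j = 1) ∨ (i = 1 ∧ j = 2) ∨ (i = 1 ∧ j = 3) ∨ (i = 1 ∧ j = 4) ∨
          (i = 2 ∧ j = 2) ∨ (i = 2 ∧ j = 3) := by omega
      all_goals
        refine Submodule.mul_mem_of_mem_span ?_ ha hb
        simp only [Set.mem_insert_iff, Set.mem_singleton_iff, forall_eq_or_imp, forall_eq]
      · exact cc2
      · exact ⟨cc3, cd3⟩
      · exact ⟨cc4, cd4, cg4⟩
      · exact ⟨cc5, cd5, cg5, ch5, ccg5⟩
      · exact ⟨⟨cc4, cd4⟩, mul_comm c d ▸ cd4, dd4⟩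
      · exact ⟨⟨cc5, cd5, cg5⟩, mul_comm c d ▸ cd5, dd5, dg5⟩
    intro i j hi hj hN a ha b hb
    rcases le_total i j with hij | hij
    · exact key i j hi hij hN a ha b hb
    · rw [mul_comm, add_comm]
      exact key j i hj hij (by omega) b hb a ha
  · intro i hi hN a ha
    obtain rfl | rfl | rfl | rfl : i = 1 ∨ i = 2 ∨ i = 3 ∨ i = 4 := by omega
    all_goals
      refine Submodule.map_mem_of_mem_span Λ ?_ ha
      simp only [Set.mem_insert_iff, Set.mem_singleton_iff, forall_eq_or_imp, forall_eq, hc, hd, hg]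
    · exact d2
    · exact ⟨d3, g3⟩
    · exact ⟨d4, g4, h4⟩
    · exact ⟨d5, g5, h5, lh5, lcg5⟩

/-- A linear functional that vanishes on the generators of the weight filtration vanishes at all
forests with at most five nodes. -/
theorem eq_zero_of_weightFiltration {R : Type*} [CommRing R] [Algebra ℝ R] {Λ : R →ₗ[ℝ] R}
    {c d g h : R} (β : R →ₗ[ℝ] ℝ)
    (hβ : ∀ x ∈ ({c, d, g, h, c * g, Λ h, Λ (c * g), c * h, c * (c * g)} : Set R), β x = 0)
    {n : ℕ} {x : R} (hx : x ∈ weightFiltration Λ c d g h n) : β x = 0 := by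
  have h5 : ∀ S : Set R, S ⊆ {c, d, g, h, c * g, Λ h, Λ (c * g), c * h, c * (c * g)} →
      x ∈ Submodule.span ℝ S → β x = 0 := fun S hS hxS =>
    (Submodule.span_le (p := LinearMap.ker β)).2 (fun y hy => hβ y (hS hy)) hxS
  rcases n with _ | _ | _ | _ | _ | n
  · rw [(Submodule.mem_bot ℝ).1 hx, map_zero]
  all_goals
    refine h5 _ (fun y hy => ?_) hx
    simp only [Set.mem_insert_iff, Set.mem_singleton_iff] at hy ⊢
    tauto

-- Sufficiency of the relations.

namespace RKScheme

/-- The relations that characterise the `4`-stage schemes in `EES(2,7)`, in terms of the abscissae,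
of `A² 1` and of `A³ 1`. -/
structure IsEffectivelySymmetric (Ψ : RKScheme 4) (s k c₃ c₄ d₃ d₄ g₄ : ℝ) : Prop where
  explicit : Ψ.IsExplicit
  sq : s ^ 2 = 2
  k_ne : k ≠ 1
  row₁ : Ψ.A 1 0 = k
  row₂ : Ψ.A 2 0 + Ψ.A 2 1 = c₃
  row₃ : Ψ.A 3 0 + Ψ.A 3 1 + Ψ.A 3 2 = c₄
  row₂' : Ψ.A 2 1 * k = d₃
  row₃' : Ψ.A 3 1 * k + Ψ.A 3 2 * c₃ = d₄
  row₃'' : Ψ.A 3 2 * d₃ = g₄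
  eq_c₃ : c₃ = s * k - s / 2 + 1
  eq_c₄ : c₄ = k + s / 2
  eq_d₃ : c₃ * (c₃ - k) = -2 * (k - 1) * d₃
  eq_d₄ : c₄ * (c₄ - k) = -2 * (k - 1) * d₄
  eq_g₄ : (1 - s) * (k - 1) * d₄ = -(1 + s) * (2 * k - 1) * g₄
  weight₀ : Ψ.b 0 + Ψ.b 1 + Ψ.b 2 + Ψ.b 3 = 1
  weight₁ : Ψ.b 1 * k + Ψ.b 2 * c₃ + Ψ.b 3 * c₄ = 1 / 2
  weight₂ : Ψ.b 2 * d₃ + Ψ.b 3 * d₄ = (2 - s) / 4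
  weight₃ : Ψ.b 3 * g₄ = (3 - 2 * s) / 8

theorem IsExplicit.mulVecLin {Ψ : RKScheme 4} (h : Ψ.IsExplicit) (v : Fin 4 → ℝ) :
    Ψ.A.mulVecLin v = ![0, Ψ.A 1 0 * v 0, Ψ.A 2 0 * v 0 + Ψ.A 2 1 * v 1,
      Ψ.A 3 0 * v 0 + Ψ.A 3 1 * v 1 + Ψ.A 3 2 * v 2] := by
  have h' : ∀ i j : Fin 4, i ≤ j → Ψ.A i j = 0 := h
  ext i
  fin_cases i <;> simp [Matrix.mulVec, dotProduct, Fin.sum_univ_four, h']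

/-- The vector with coordinates `a, b, e, f` in the basis `1, A 1, A² 1, A³ 1`. -/
def comb (k c₃ c₄ d₃ d₄ g₄ a b e f : ℝ) : Fin 4 → ℝ :=
  ![a, a + b * k, a + b * c₃ + e * d₃, a + b * c₄ + e * d₄ + f * g₄]

namespace IsEffectivelySymmetric

variable {Ψ : RKScheme 4} {s k c₃ c₄ d₃ d₄ g₄ : ℝ}

local notation "⟪" a "," b "," e "," f "⟫" => comb k c₃ c₄ d₃ d₄ g₄ a b e f

theorem comb_congr {a b e f a' b' e' f' : ℝ} (ha : a = a') (hb : b = b') (he : e = e')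
    (hf : f = f') : ⟪a, b, e, f⟫ = ⟪a', b', e', f'⟫ := by
  rw [ha, hb, he, hf]

theorem comb_add (a b e f a' b' e' f' : ℝ) :
    ⟪a, b, e, f⟫ + ⟪a', b', e', f'⟫ = ⟪a + a', b + b', e + e', f + f'⟫ := by
  ext i
  fin_cases i <;> simp [comb] <;> ring

theorem comb_sub (a b e f a' b' e' f' : ℝ) :
    ⟪a, b, e, f⟫ - ⟪a', b', e', f'⟫ = ⟪a - a', b - b', e - e', f - f'⟫ := by
  ext i
  fin_cases i <;> simp [comb] <;> ring

theorem smul_comb (r a b e f : ℝ) : r • ⟪a, b, e, f⟫ = ⟪r * a, r * b, r * e, r * f⟫ := by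
  ext i
  fin_cases i <;> simp [comb] <;> ring

theorem one_eq_comb : (1 : Fin 4 → ℝ) = ⟪1, 0, 0, 0⟫ := by
  ext i
  fin_cases i <;> simp [comb]

theorem weight_comb (H : Ψ.IsEffectivelySymmetric s k c₃ c₄ d₃ d₄ g₄) (a b e f : ℝ) :
    Ψ.weight ⟪a, b, e, f⟫ = a + b / 2 + e * ((2 - s) / 4) + f * ((3 - 2 * s) / 8) := by
  rw [weight_apply, Fin.sum_univ_four]
  simp only [comb, Matrix.cons_val]
  linear_combination a * H.weight₀ + b * H.weight₁ + e * H.weight₂ + f * H.weight₃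

theorem mulVecLin_comb (H : Ψ.IsEffectivelySymmetric s k c₃ c₄ d₃ d₄ g₄) (a b e f : ℝ) :
    Ψ.A.mulVecLin ⟪a, b, e, f⟫ = ⟪0, a, b, e⟫ := by
  rw [H.explicit.mulVecLin]
  ext i
  fin_cases i
  · simp [comb]
  · simp [comb, H.row₁, mul_comm]
  · simp [comb]
    linear_combination a * H.row₂ + b * H.row₂'
  · simp [comb]
    linear_combination a * H.row₃ + b * H.row₃' + e * H.row₃''

theorem adjoint_comb (H : Ψ.IsEffectivelySymmetric s k c₃ c₄ d₃ d₄ g₄) (a b e f : ℝ) :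
    Ψ.adjoint.A.mulVecLin ⟪a, b, e, f⟫ =
      ⟪a + b / 2 + e * ((2 - s) / 4) + f * ((3 - 2 * s) / 8), -a, -b, -e⟫ := by
  rw [adjoint_mulVecLin, H.weight_comb, H.mulVecLin_comb, one_eq_comb, smul_comb, comb_sub]
  exact comb_congr (by ring) (by ring) (by ring) (by ring)

/-- The relations `eq_d₃`, `eq_d₄` and `eq_g₄` say exactly that `c² = k c - 2(k - 1) d` and `c d =
c₃ d - (1 + s)(2k - 1) g`, because `c₄ - c₃ = (1 - s)(k - 1)`. -/
theorem mul_comb (H : Ψ.IsEffectivelySymmetric s k c₃ c₄ d₃ d₄ g₄) (a b e f : ℝ) :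
    ⟪0, 1, 0, 0⟫ * ⟪a, b, e, f⟫ = ⟪0, a + b * k, c₃ * e - 2 * (k - 1) * b,
        c₄ * f - (1 + s) * (2 * k - 1) * e⟫ := by
  ext i
  fin_cases i
  · simp [comb]
  · simp [comb]
    ring
  · simp [comb]
    linear_combination b * H.eq_d₃
  · simp [comb]
    linear_combination b * H.eq_d₄ + e * H.eq_g₄ + e * d₄ * (H.eq_c₄ - H.eq_c₃)

theorem adjoint_mul_comb (H : Ψ.IsEffectivelySymmetric s k c₃ c₄ d₃ d₄ g₄) (a b e f : ℝ) :
    ⟪1, -1, 0, 0⟫ * ⟪a, b, e, f⟫ = ⟪a, b - (a + b * k), e - (c₃ * e - 2 * (k - 1) * b),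
        f - (c₄ * f - (1 + s) * (2 * k - 1) * e)⟫ := by
  have h1 : ⟪1, -1, 0, 0⟫ = 1 - ⟪0, 1, 0, 0⟫ := by
    rw [one_eq_comb, comb_sub]
    exact comb_congr (by ring) (by ring) (by ring) (by ring)
  rw [h1, sub_mul, one_mul, H.mul_comb, comb_sub, sub_zero]

theorem adjoint_weight (Ψ : RKScheme 4) : Ψ.adjoint.weight = Ψ.weight := rfl

/-- Both schemes are run at once in the ring `ℝ⁴ × ℝ⁴`, with `A` on the first factor and `A*` on the
second. The difference of the two weights is a single linear functional there, so it is enough that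
it kills the generators of the filtration. -/
theorem weight_stages_eq (H : Ψ.IsEffectivelySymmetric s k c₃ c₄ d₃ d₄ g₄) (F : Forest)
    (hF : (F.map RTree.size).sum ≤ 5) :
    Ψ.weight (Ψ.stages (forest F)) = Ψ.weight (Ψ.adjoint.stages (forest F)) := by
  rcases eq_or_ne F 0 with rfl | hF0
  · simp [forest_zero]
  let Λ : ((Fin 4 → ℝ) × (Fin 4 → ℝ)) →ₗ[ℝ] ((Fin 4 → ℝ) × (Fin 4 → ℝ)) :=
    Ψ.A.mulVecLin.prodMap Ψ.adjoint.A.mulVecLin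
  have hΛ : ∀ a b e f a' b' e' f' : ℝ, Λ (⟪a, b, e, f⟫, ⟪a', b', e', f'⟫) = (⟪0, a, b, e⟫,
      ⟪a' + b' / 2 + e' * ((2 - s) / 4) + f' * ((3 - 2 * s) / 8), -a', -b', -e'⟫) := by
    intro a b e f a' b' e' f'
    simp only [Λ, LinearMap.prodMap_apply, H.mulVecLin_comb, H.adjoint_comb]
  have hmul : ∀ a b e f a' b' e' f' : ℝ,
      ((⟪0, 1, 0, 0⟫, ⟪1, -1, 0, 0⟫) : (Fin 4 → ℝ) × (Fin 4 → ℝ)) *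
        (⟪a, b, e, f⟫, ⟪a', b', e', f'⟫) =
      (⟪0, a + b * k, c₃ * e - 2 * (k - 1) * b, c₄ * f - (1 + s) * (2 * k - 1) * e⟫,
      ⟪a', b' - (a' + b' * k), e' - (c₃ * e' - 2 * (k - 1) * b'),
        f' - (c₄ * f' - (1 + s) * (2 * k - 1) * e')⟫) := by
    intro a b e f a' b' e' f'
    rw [Prod.mk_mul_mk, H.mul_comb, H.adjoint_mul_comb]
  let β : ((Fin 4 → ℝ) × (Fin 4 → ℝ)) →ₗ[ℝ] ℝ :=
    Ψ.weight ∘ₗ LinearMap.fst ℝ _ _ - Ψ.weight ∘ₗ LinearMap.snd ℝ _ _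
  have hβ : ∀ a b e f a' b' e' f' : ℝ, β (⟪a, b, e, f⟫, ⟪a', b', e', f'⟫) =
      (a + b / 2 + e * ((2 - s) / 4) + f * ((3 - 2 * s) / 8)) -
      (a' + b' / 2 + e' * ((2 - s) / 4) + f' * ((3 - 2 * s) / 8)) := by
    intro a b e f a' b' e' f'
    simp [β, H.weight_comb]
  have hs := H.sq
  have hc₃ := H.eq_c₃
  have hc₄ := H.eq_c₄
  -- The pairs `c`, `d`, `g`, `h` are `(Aʲ 1, A*ʲ 1)` for `j = 1, …, 4`; the first entry of `h` is
  -- zero because `A⁴ 1 = 0`.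
  have hmem := forest_mem_weightFiltration (Ψ.stages.prod Ψ.adjoint.stages) Λ
    (c := (⟪0, 1, 0, 0⟫, ⟪1, -1, 0, 0⟫)) (d := (⟪0, 0, 1, 0⟫, ⟪1 / 2, -1, 1, 0⟫))
    (g := (⟪0, 0, 0, 1⟫, ⟪(2 - s) / 4, -1 / 2, 1, -1⟫))
    (h := (⟪0, 0, 0, 0⟫, ⟪(3 - 2 * s) / 8, -(2 - s) / 4, 1 / 2, -1⟫))
    (k := k) (μ := -2 * (k - 1)) (κ := c₃) (ρ := -(1 + s) * (2 * k - 1))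
    (fun x => by simp [Λ, stages_graft])
    (mul_ne_zero (by norm_num) (sub_ne_zero.2 H.k_ne))
    (by
      rw [← Prod.mk_one_one, one_eq_comb (k := k) (c₃ := c₃) (c₄ := c₄) (d₃ := d₃) (d₄ := d₄)
        (g₄ := g₄), hΛ]
      refine Prod.ext (comb_congr ?_ ?_ ?_ ?_) (comb_congr ?_ ?_ ?_ ?_) <;> grind)
    (by rw [hΛ]; refine Prod.ext (comb_congr ?_ ?_ ?_ ?_) (comb_congr ?_ ?_ ?_ ?_) <;> grind)
    (by rw [hΛ]; refine Prod.ext (comb_congr ?_ ?_ ?_ ?_) (comb_congr ?_ ?_ ?_ ?_) <;> grind)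
    (by rw [hΛ]; refine Prod.ext (comb_congr ?_ ?_ ?_ ?_) (comb_congr ?_ ?_ ?_ ?_) <;> grind)
    (by
      rw [hmul, Prod.smul_mk, Prod.smul_mk, smul_comb, smul_comb, smul_comb, smul_comb,
        Prod.mk_add_mk, comb_add, comb_add]
      refine Prod.ext (comb_congr ?_ ?_ ?_ ?_) (comb_congr ?_ ?_ ?_ ?_) <;> grind)
    (by
      rw [hmul, Prod.smul_mk, Prod.smul_mk, smul_comb, smul_comb, smul_comb, smul_comb,
        Prod.mk_add_mk, comb_add, comb_add]
      refine Prod.ext (comb_congr ?_ ?_ ?_ ?_) (comb_congr ?_ ?_ ?_ ?_) <;> grind)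
    F hF0 hF
  have h0 := eq_zero_of_weightFiltration β (by
    simp only [Set.mem_insert_iff, Set.mem_singleton_iff, forall_eq_or_imp, forall_eq, hmul, hΛ, hβ]
    refine ⟨?_, ?_, ?_, ?_, ?_, ?_, ?_, ?_, ?_⟩ <;> grind) hmem
  exact sub_eq_zero.1 h0

end IsEffectivelySymmetric

end RKScheme

namespace RTree

/-- The tree with `n + 1` nodes that has no branching. -/
noncomputable def tall : ℕ → RTree
  | 0 => node 0
  | n + 1 => node {tall n}

theorem size_tall (n : ℕ) : (tall n).size = n + 1 := by
  induction n with
  | zero => simp [tall, size_node]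
  | succ n ih => simp [tall, size_node, ih, add_comm]

end RTree

namespace RKScheme

theorem stages_tall {s : ℕ} (Ψ : RKScheme s) (n : ℕ) :
    Ψ.stages (tree (RTree.tall n)) = (Ψ.A.mulVecLin)^[n + 1] 1 := by
  induction n with
  | zero => simp [RTree.tall, stages_node, forest_zero]
  | succ n ih =>
    rw [RTree.tall, stages_node, forest_singleton, ih, Function.iterate_succ_apply' _ (n + 1)]

theorem character_tall {s : ℕ} (Ψ : RKScheme s) (n : ℕ) :
    Ψ.character (tree (RTree.tall n)) = Ψ.weight ((Ψ.A.mulVecLin)^[n] 1) := by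
  cases n with
  | zero => simp [RTree.tall, character_node, forest_zero]
  | succ n => rw [RTree.tall, character_node, forest_singleton, stages_tall]

theorem not_order_three {s : ℕ} {Ψ : RKScheme s}
    (h : Ψ.weight ((Ψ.A.mulVecLin)^[2] 1) ≠ 1 / 6) :
    ¬ ∀ τ : RTree, τ.size ≤ 3 → Ψ.character (tree τ) = 1 / (τ.factorial : ℝ) := by
  intro h'
  have h1 := h' (RTree.tall 2) (by rw [RTree.size_tall])
  have h2 : (RTree.tall 2).factorial = 6 := by
    simp [RTree.tall, RTree.factorial_node, RTree.size_node]
  rw [character_tall, h2] at h1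
  exact h (by simpa using h1)

theorem IsEffectivelySymmetric.isEES {Ψ : RKScheme 4} {s k c₃ c₄ d₃ d₄ g₄ : ℝ}
    (H : Ψ.IsEffectivelySymmetric s k c₃ c₄ d₃ d₄ g₄) : Ψ.IsEES 2 7 := by
  have hs := H.sq
  have hone := IsEffectivelySymmetric.one_eq_comb (k := k) (c₃ := c₃) (c₄ := c₄) (d₃ := d₃)
    (d₄ := d₄) (g₄ := g₄)
  refine Ψ.isEES_two_seven_iff.2 ⟨H.explicit, ⟨?_, ?_, not_order_three ?_⟩, ?_, ?_⟩
  · rw [hone, H.weight_comb]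
    ring
  · rw [hone, H.mulVecLin_comb, H.weight_comb]
    ring
  · simp only [Function.iterate_succ_apply', Function.iterate_zero_apply, hone, H.mulVecLin_comb,
      H.weight_comb]
    -- Here `(2 - s)/4 = 1/6` would give `s = 4/3`, against `s² = 2`.
    intro h
    nlinarith
  · intro τ hτ
    obtain ⟨F, rfl⟩ := RTree.exists_eq_node τ
    rw [RTree.size_node] at hτ
    rw [character_node, character_node]
    exact H.weight_stages_eq F (by omega)
  · intro h
    -- `A⁷ 1 = 0`, while `A*⁷ 1 = -P g` with `P = (3 - 2s)/8`; so the weights are `0` and `-P²`.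
    have h1 := h (RTree.tall 7) (by rw [RTree.size_tall])
    rw [character_tall, character_tall, IsEffectivelySymmetric.adjoint_weight] at h1
    simp only [Function.iterate_succ_apply', Function.iterate_zero_apply, hone, H.mulVecLin_comb,
      H.adjoint_comb, H.weight_comb] at h1
    grind

-- Necessity of the relations.

theorem weight_stages_eq_of_agreeUpTo {s n : ℕ} {Ψ : RKScheme s}
    (h : AgreeUpTo (n + 1) Ψ.character Ψ.adjoint.character) (F : Forest)
    (hF : (F.map RTree.size).sum ≤ n) :
    Ψ.weight (Ψ.stages (forest F)) = Ψ.weight (Ψ.adjoint.stages (forest F)) := by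
  have h1 := h (RTree.node F) (by rw [RTree.size_node]; omega)
  rwa [character_node, character_node] at h1

/-- Consequences, in terms of `c = A 1`, `d = A c` and `g = A d`, of the agreement of a scheme with its
adjoint up to order six. -/
theorem moments_of_agreeUpTo_six {s : ℕ} {Ψ : RKScheme s} {c d g : Fin s → ℝ} {k : ℝ}
    (H : AgreeUpTo 6 Ψ.character Ψ.adjoint.character)
    (h1 : Ψ.A.mulVecLin 1 = c) (hc : Ψ.A.mulVecLin c = d) (hd : Ψ.A.mulVecLin d = g)
    (hg : Ψ.A.mulVecLin g = 0)
    (hcc : Ψ.A.mulVecLin (Ψ.A.mulVecLin (c * c)) = k • g)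
    (hcd : Ψ.A.mulVecLin (Ψ.A.mulVecLin (c * d)) = 0)
    (b1 : Ψ.weight 1 = 1) (bc : Ψ.weight c = 1 / 2) {p q r u v z : ℝ}
    (bd : Ψ.weight d = p) (bcc : Ψ.weight (c * c) = q)
    (bLcc : Ψ.weight (Ψ.A.mulVecLin (c * c)) = r) (bcd : Ψ.weight (c * d) = u)
    (bLcd : Ψ.weight (Ψ.A.mulVecLin (c * d)) = z) (bcg : Ψ.weight (c * g) = v) :
    p ^ 2 = p - 1 / 8 ∧ Ψ.weight g = p ^ 2 ∧ 2 * u = p + q - 1 / 4 ∧ 2 * r = q + 2 * p - 1 / 2 ∧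
      k * p ^ 2 = r / 2 - q * p + p ^ 2 ∧ z = u / 2 - p / 2 + 3 / 2 * p ^ 2 - k * p ^ 2 ∧
      (2 * k - 2) * v = r / 2 - q / 2 + q ^ 2 + p - u + (k - 2) * p ^ 2 := by
  have hβ := fun F => weight_stages_eq_of_agreeUpTo (n := 5) H F
  obtain ⟨P, bg⟩ : ∃ P, Ψ.weight g = P := ⟨_, rfl⟩
  have star := Ψ.adjoint_mulVecLin
  have s1 : Ψ.adjoint.A.mulVecLin 1 = 1 - c := by rw [star, b1, h1, one_smul]
  have s2 : Ψ.adjoint.A.mulVecLin (1 - c) = (1 / 2 : ℝ) • (1 : Fin s → ℝ) - c + d := by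
    rw [star, map_sub, map_sub, b1, bc, h1, hc]
    module
  have s3 : Ψ.adjoint.A.mulVecLin ((1 / 2 : ℝ) • (1 : Fin s → ℝ) - c + d) =
      p • (1 : Fin s → ℝ) - (1 / 2 : ℝ) • c + d - g := by
    rw [star]
    simp only [map_sub, map_add, map_smul, b1, bc, bd, h1, hc, hd, smul_eq_mul]
    module
  -- This gives `2P = 2p - 1/4`, which also simplifies the constant coefficient in `s4`.
  have e4 := hβ {RTree.tall 2} (by simp [RTree.size_tall])
  simp only [forest_singleton, stages_tall, Function.iterate_succ_apply',
    Function.iterate_zero_apply, h1, hc, hd, s1, s2, s3, map_sub, map_add, map_smul, b1, bc, bd,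
    bg, smul_eq_mul] at e4
  have s4 : Ψ.adjoint.A.mulVecLin (p • (1 : Fin s → ℝ) - (1 / 2 : ℝ) • c + d - g) =
      P • (1 : Fin s → ℝ) - p • c + (1 / 2 : ℝ) • d - g := by
    rw [star]
    simp only [map_sub, map_add, map_smul, b1, bc, bd, bg, h1, hc, hd, hg, smul_eq_mul, ← e4]
    module
  have s5 : Ψ.adjoint.A.mulVecLin (P • (1 : Fin s → ℝ) - p • c + (1 / 2 : ℝ) • d - g) =
      p • d - P • c - (1 / 2 : ℝ) • g := by
    have e : P - p * (1 / 2) + 1 / 2 * p - P = 0 := by ring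
    rw [star]
    simp only [map_sub, map_add, map_smul, b1, bc, bd, bg, h1, hc, hd, hg, smul_eq_mul, mul_one, e]
    module
  -- The weight is `0` since `A⁵ 1 = 0`, and the adjoint weight is `p² - P`.
  have e6 := hβ {RTree.tall 4} (by simp [RTree.size_tall])
  simp only [forest_singleton, stages_tall, Function.iterate_succ_apply',
    Function.iterate_zero_apply, h1, hc, hd, hg, s1, s2, s3, s4, s5, map_sub, map_smul,
    map_zero, bc, bd, bg, smul_eq_mul] at e6
  have hP : P = p ^ 2 := by linarith
  have hp : p ^ 2 = p - 1 / 8 := by linarith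
  -- trees built on the product `c * c`
  have w0 : (1 - c) * (1 - c) = 1 - (2 : ℝ) • c + c * c := by
    rw [two_smul]
    ring
  have w1 : Ψ.adjoint.A.mulVecLin (1 - (2 : ℝ) • c + c * c) =
      q • (1 : Fin s → ℝ) - c + (2 : ℝ) • d - Ψ.A.mulVecLin (c * c) := by
    have e : 1 - 2 * (1 / 2) + q = q := by ring
    rw [star]
    simp only [map_sub, map_add, map_smul, b1, bc, bcc, h1, hc, smul_eq_mul, e]
    module
  have f4 := hβ {RTree.node ({RTree.tall 0} + {RTree.tall 0})}
    (by simp [RTree.size_tall, RTree.size_node])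
  simp only [forest_singleton, forest_add, stages_node, map_mul, stages_tall,
    Function.iterate_succ_apply', Function.iterate_zero_apply, h1, s1, w0, w1, map_sub, map_add,
    map_smul, b1, bc, bd, bLcc, smul_eq_mul] at f4
  have w2 : Ψ.adjoint.A.mulVecLin (q • (1 : Fin s → ℝ) - c + (2 : ℝ) • d - Ψ.A.mulVecLin (c * c)) =
      r • (1 : Fin s → ℝ) - q • c + d + (k - 2) • g := by
    have e : q * 1 - 1 / 2 + 2 * p - r = r := by linarith
    rw [star]
    simp only [map_sub, map_add, map_smul, b1, bc, bd, bLcc, h1, hc, hd, hcc, smul_eq_mul, e]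
    module
  have w3 : Ψ.adjoint.A.mulVecLin (r • (1 : Fin s → ℝ) - q • c + d + (k - 2) • g) =
      (r - q / 2 + p + (k - 2) * P) • (1 : Fin s → ℝ) - r • c + q • d - g := by
    rw [star]
    simp only [map_sub, map_add, map_smul, b1, bc, bd, bg, h1, hc, hd, hg, smul_eq_mul]
    module
  -- The left side vanishes because `A³(c²) = k A g = 0`, so this fixes `k P`.
  have f6 := hβ {RTree.node {RTree.node {RTree.node ({RTree.tall 0} + {RTree.tall 0})}}}
    (by simp [RTree.size_tall, RTree.size_node])
  simp only [forest_singleton, forest_add, stages_node, map_mul, stages_tall,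
    Function.iterate_succ_apply', Function.iterate_zero_apply, h1, s1, w0, w1, w2, w3, hcc, hg,
    smul_zero, map_zero, map_sub, map_add, map_smul, b1, bc, bd, bg, smul_eq_mul] at f6
  -- trees built on the product `c * d`
  have y0 : (1 - c) * ((1 / 2 : ℝ) • (1 : Fin s → ℝ) - c + d) =
      (1 / 2 : ℝ) • (1 : Fin s → ℝ) - (3 / 2 : ℝ) • c + d + c * c - c * d := by
    ext i
    simp
    ring
  have g4 := hβ ({RTree.tall 0} + {RTree.tall 1}) (by simp [RTree.size_tall])
  simp only [forest_singleton, forest_add, map_mul, stages_tall, Function.iterate_succ_apply',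
    Function.iterate_zero_apply, h1, hc, s1, s2, y0, map_sub, map_add, map_smul, b1, bc, bd, bcc,
    bcd, smul_eq_mul] at g4
  have y1 : Ψ.adjoint.A.mulVecLin
      ((1 / 2 : ℝ) • (1 : Fin s → ℝ) - (3 / 2 : ℝ) • c + d + c * c - c * d) =
      u • (1 : Fin s → ℝ) - (1 / 2 : ℝ) • c + (3 / 2 : ℝ) • d - g - Ψ.A.mulVecLin (c * c) +
        Ψ.A.mulVecLin (c * d) := by
    have e : 1 / 2 * 1 - 3 / 2 * (1 / 2) + p + q - u = u := by linarith
    rw [star]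
    simp only [map_sub, map_add, map_smul, b1, bc, bd, bcc, bcd, h1, hc, hd, smul_eq_mul, e]
    module
  have y2 : Ψ.adjoint.A.mulVecLin
      (u • (1 : Fin s → ℝ) - (1 / 2 : ℝ) • c + (3 / 2 : ℝ) • d - g - Ψ.A.mulVecLin (c * c) +
        Ψ.A.mulVecLin (c * d)) =
      (u - 1 / 4 + 3 / 2 * p - P - r + z) • (1 : Fin s → ℝ) - u • c + (1 / 2 : ℝ) • d +
        (k - 3 / 2) • g := by
    rw [star]
    simp only [map_sub, map_add, map_smul, b1, bc, bd, bg, bLcc, bLcd, h1, hc, hd, hg, hcc, hcd,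
      smul_eq_mul]
    module
  have g6 := hβ {RTree.node {RTree.node ({RTree.tall 0} + {RTree.tall 1})}}
    (by simp [RTree.size_tall, RTree.size_node])
  simp only [forest_singleton, forest_add, stages_node, map_mul, stages_tall,
    Function.iterate_succ_apply', Function.iterate_zero_apply, h1, hc, s1, s2, y0, y1, y2, hcd,
    map_zero, map_sub, map_add, map_smul, b1, bc, bd, bg, smul_eq_mul] at g6
  have x0 : (1 - c) * (r • (1 : Fin s → ℝ) - q • c + d + (k - 2) • g) =
      r • (1 : Fin s → ℝ) - (q + r) • c + d + (k - 2) • g + q • (c * c) - c * d -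
        (k - 2) • (c * g) := by
    ext i
    simp
    ring
  have k6 := hβ ({RTree.tall 0} + {RTree.node {RTree.node ({RTree.tall 0} + {RTree.tall 0})}})
    (by simp [RTree.size_tall, RTree.size_node])
  simp only [forest_singleton, forest_add, stages_node, map_mul, stages_tall,
    Function.iterate_succ_apply', Function.iterate_zero_apply, h1, s1, w0, w1, w2, x0, hcc,
    mul_smul_comm, map_sub, map_add, map_smul, b1, bc, bd, bg, bcc, bcd, bcg, smul_eq_mul] at k6
  refine ⟨hp, bg.trans hP, ?_, ?_, ?_, ?_, ?_⟩
  · linarith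
  · linarith
  · rw [← hP]
    linarith
  · rw [← hP]
    linarith
  · rw [← hP]
    linarith

/-- The unknowns can be eliminated in turn: `u` and `r` are affine in `q`, then `hk` has `q` with
coefficient `(s - 1)/4`, and `c₃`, `c₄` carry the factor `(3 - 2s)/8`; both are invertible when `s²
= 2`. The factor `k - 1` remains because `k ≠ 1` is not yet known. -/
theorem solve_moments {s k q r u c₃ c₄ : ℝ} (hs : s ^ 2 = 2)
    (hu : 2 * u = (2 - s) / 4 + q - 1 / 4) (hr : 2 * r = q + 2 * ((2 - s) / 4) - 1 / 2)
    (hk : k * ((3 - 2 * s) / 8) = r / 2 - q * ((2 - s) / 4) + (3 - 2 * s) / 8)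
    (hc₃ : c₃ * ((3 - 2 * s) / 8) = u / 2 - (2 - s) / 4 / 2 + 3 / 2 * ((3 - 2 * s) / 8) -
      k * ((3 - 2 * s) / 8))
    (hc₄ : (2 * k - 2) * (c₄ * ((3 - 2 * s) / 8)) = r / 2 - q / 2 + q ^ 2 + (2 - s) / 4 - u +
      (k - 2) * ((3 - 2 * s) / 8)) :
    q = 1 - s / 2 + (s - 1) / 2 * k ∧ r = 3 / 4 - s / 2 + (s - 1) / 4 * k ∧
      u = 5 / 8 - 3 / 8 * s + (s - 1) / 4 * k ∧ c₃ = s * k - s / 2 + 1 ∧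
      (k - 1) * (c₄ - (k + s / 2)) = 0 := by
  have hq : q = 1 - s / 2 + (s - 1) / 2 * k := by grind
  have hr' : r = 3 / 4 - s / 2 + (s - 1) / 4 * k := by grind
  have hu' : u = 5 / 8 - 3 / 8 * s + (s - 1) / 4 * k := by grind
  subst hq hr' hu'
  exact ⟨rfl, rfl, rfl, by grind, by grind⟩

theorem IsEES.exists_isEffectivelySymmetric {Ψ : RKScheme 4} (h : Ψ.IsEES 2 7) :
    ∃ s k c₃ c₄ d₃ d₄ g₄ : ℝ, Ψ.IsEffectivelySymmetric s k c₃ c₄ d₃ d₄ g₄ ∧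
      k ≠ 0 ∧ d₃ ≠ 0 ∧ g₄ ≠ 0 := by
  obtain ⟨hE, ⟨b1, bc, -⟩, H, -⟩ := Ψ.isEES_two_seven_iff.1 h
  have hL := hE.mulVecLin
  obtain ⟨k, hk⟩ : ∃ k, Ψ.A 1 0 = k := ⟨_, rfl⟩
  obtain ⟨c₃, hc₃⟩ : ∃ c₃, Ψ.A 2 0 + Ψ.A 2 1 = c₃ := ⟨_, rfl⟩
  obtain ⟨c₄, hc₄⟩ : ∃ c₄, Ψ.A 3 0 + Ψ.A 3 1 + Ψ.A 3 2 = c₄ := ⟨_, rfl⟩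
  obtain ⟨d₃, hd₃⟩ : ∃ d₃, Ψ.A 2 1 * k = d₃ := ⟨_, rfl⟩
  obtain ⟨d₄, hd₄⟩ : ∃ d₄, Ψ.A 3 1 * k + Ψ.A 3 2 * c₃ = d₄ := ⟨_, rfl⟩
  obtain ⟨g₄, hg₄⟩ : ∃ g₄, Ψ.A 3 2 * d₃ = g₄ := ⟨_, rfl⟩
  have h1 : Ψ.A.mulVecLin 1 = ![0, k, c₃, c₄] := by simp [hL, hk, hc₃, hc₄]
  have hc : Ψ.A.mulVecLin ![0, k, c₃, c₄] = ![0, 0, d₃, d₄] := by simp [hL, hd₃, hd₄]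
  have hd : Ψ.A.mulVecLin ![0, 0, d₃, d₄] = ![0, 0, 0, g₄] := by simp [hL, hg₄]
  have hg : Ψ.A.mulVecLin ![0, 0, 0, g₄] = 0 := by
    rw [hL]
    ext i
    fin_cases i <;> simp
  have hcc1 : Ψ.A.mulVecLin (![0, k, c₃, c₄] * ![0, k, c₃, c₄]) =
      ![0, 0, d₃ * k, Ψ.A 3 1 * k ^ 2 + Ψ.A 3 2 * c₃ ^ 2] := by
    rw [hL]
    ext i
    fin_cases i <;> simp
    · rw [← hd₃]
      ring
    · ring
  have hcc : Ψ.A.mulVecLin (Ψ.A.mulVecLin (![0, k, c₃, c₄] * ![0, k, c₃, c₄])) =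
      k • ![0, 0, 0, g₄] := by
    rw [hcc1, hL]
    ext i
    fin_cases i <;> simp
    rw [← hg₄]
    ring
  have hcd1 : Ψ.A.mulVecLin (![0, k, c₃, c₄] * ![0, 0, d₃, d₄]) = c₃ • ![0, 0, 0, g₄] := by
    rw [hL]
    ext i
    fin_cases i <;> simp
    rw [← hg₄]
    ring
  have hcd : Ψ.A.mulVecLin (Ψ.A.mulVecLin (![0, k, c₃, c₄] * ![0, 0, d₃, d₄])) = 0 := by
    rw [hcd1, map_smul, hg, smul_zero]
  have hcg : ![0, k, c₃, c₄] * ![0, 0, 0, g₄] = c₄ • ![0, 0, 0, g₄] := by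
    ext i
    fin_cases i <;> simp
  rw [h1] at bc
  obtain ⟨p, bd⟩ : ∃ p, Ψ.weight ![0, 0, d₃, d₄] = p := ⟨_, rfl⟩
  obtain ⟨q, bcc⟩ : ∃ q, Ψ.weight (![0, k, c₃, c₄] * ![0, k, c₃, c₄]) = q := ⟨_, rfl⟩
  obtain ⟨r, br⟩ : ∃ r, Ψ.weight (Ψ.A.mulVecLin (![0, k, c₃, c₄] * ![0, k, c₃, c₄])) = r :=
    ⟨_, rfl⟩
  obtain ⟨u, bcd⟩ : ∃ u, Ψ.weight (![0, k, c₃, c₄] * ![0, 0, d₃, d₄]) = u := ⟨_, rfl⟩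
  obtain ⟨hp, bg, hu, hr, hkp, hz, hv⟩ := moments_of_agreeUpTo_six H h1 hc hd hg hcc hcd b1 bc bd
    bcc br bcd rfl rfl
  rw [hcd1, map_smul, bg, smul_eq_mul] at hz
  rw [hcg, map_smul, bg, smul_eq_mul] at hv
  obtain ⟨s, hps⟩ : ∃ s, p = (2 - s) / 4 := ⟨2 - 4 * p, by ring⟩
  have hs : s ^ 2 = 2 := by
    rw [hps] at hp
    linarith
  have hp2 : p ^ 2 = (3 - 2 * s) / 8 := by
    rw [hps]
    linarith
  rw [hp2] at hkp hz hv bg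
  -- In `hz` and `hv` the moments of `A (c d) = c₃ g` and `c g = c₄ g₄ e₄`, with `e₄` the last unit
  -- vector, have become `c₃ P` and `c₄ P`, so the abscissae can be solved for.
  subst hps
  obtain ⟨hq, hr', hu', ec₃, ec₄'⟩ := solve_moments hs hu hr hkp hz hv
  have hP : (3 - 2 * s) / 8 ≠ 0 := by
    intro h
    rw [show s = 3 / 2 by linarith] at hs
    norm_num at hs
  rw [weight_apply, Fin.sum_univ_four] at b1 bc bd bcc bcd bg
  rw [hcc1, weight_apply, Fin.sum_univ_four] at br
  simp only [Pi.one_apply, Pi.mul_apply, Matrix.cons_val, mul_zero, mul_one, zero_add]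
    at b1 bc bd bcc br bcd bg
  have hb3 : Ψ.b 3 ≠ 0 := fun h => hP (by rw [← bg, h, zero_mul])
  have hg₄0 : g₄ ≠ 0 := fun h => hP (by rw [← bg, h, mul_zero])
  have hA32 : Ψ.A 3 2 ≠ 0 := fun h => hg₄0 (by rw [← hg₄, h, zero_mul])
  have hd₃0 : d₃ ≠ 0 := fun h => hg₄0 (by rw [← hg₄, h, mul_zero])
  have hk0 : k ≠ 0 := fun h => hd₃0 (by rw [← hd₃, h, mul_zero])
  -- Let `w = c² - k c + 2(k - 1) d`, which vanishes at the first two stages. The moment `b·A w = 0`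
  -- sees only its third entry, with factor `b₄ a₄₃ ≠ 0`; then `b·w = 0` gives the fourth. The
  -- relation `eg₄` arises likewise from `c d - c₃ d + (1 + s)(2k - 1) g`.
  have ed₃ : c₃ * (c₃ - k) = -2 * (k - 1) * d₃ := by
    refine mul_left_cancel₀ (mul_ne_zero hb3 hA32) ?_
    linear_combination br - k * bd - Ψ.b 3 * k * hd₄ + 2 * (k - 1) * Ψ.b 3 * hg₄ +
      2 * (k - 1) * bg + hr'
  have ed₄ : c₄ * (c₄ - k) = -2 * (k - 1) * d₄ := by
    refine mul_left_cancel₀ hb3 ?_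
    linear_combination bcc - k * bc - Ψ.b 2 * ed₃ + 2 * (k - 1) * bd + hq
  have hk1 : k ≠ 1 := by
    rintro rfl
    -- For `k = 1` the relation reads `(1 + s/2)(s/2) = 0`, so `s² = 2` would force `s = -1`.
    rw [ec₃] at ed₃
    rw [show s = -1 by linarith] at hs
    norm_num at hs
  have ec₄ : c₄ = k + s / 2 := sub_eq_zero.1
    ((mul_eq_zero.1 ec₄').resolve_left (sub_ne_zero.2 hk1))
  have eg₄ : (1 - s) * (k - 1) * d₄ = -(1 + s) * (2 * k - 1) * g₄ := by
    refine mul_left_cancel₀ hb3 ?_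
    linear_combination bcd - c₃ * bd - Ψ.b 3 * d₄ * (ec₄ - ec₃) + hu' + (1 + s) * (2 * k - 1) * bg -
      (2 - s) / 4 * ec₃ - (2 * k - 1) / 8 * hs
  exact ⟨s, k, c₃, c₄, d₃, d₄, g₄, ⟨hE, hs, hk1, hk, hc₃, hc₄, hd₃, hd₄, hg₄, ec₃, ec₄, ed₃, ed₄,
    eg₄, b1, bc, bd, bg⟩, hk0, hd₃0, hg₄0⟩

-- The one-parameter family.

/-- The one-parameter family of `4`-stage schemes in `EES(2,7)`, for `s = ±√2`. -/
noncomputable def eesFamily (s x : ℝ) : RKScheme 4 where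
  A := !![0, 0, 0, 0;
    (-2 + s * (1 - 2 * x)) / (4 * (x - 1)), 0, 0, 0;
    (2 * x + s - 2) * (4 * x + s - 2) / (4 * s * (x - 1)) *
      ((2 * x + s) / ((2 * x - 1) * (-2 * x - s + 1))),
    (-1 + s) / 2 * ((2 * x + s) / ((2 * x - 1) * (-2 * x - s + 1))), 0, 0;
    (-40 * x ^ 4 + (80 - 40 * s) * x ^ 3 - (88 - 60 * s) * x ^ 2
        + (48 - 34 * s) * x + 7 * s - 10) / (2 * (x - 1) * (2 * x + s)) *
      (1 / ((2 * x - 1) * (1 - s - 2 * x) * (2 - s - 2 * x))),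
    (2 - s) * x * (x - 1) * (4 * x + s - 2) *
      (1 / ((2 * x - 1) * (1 - s - 2 * x) * (2 - s - 2 * x))),
    (2 - s) * (x - 1) * (2 * x - 1) / ((2 * x + s) * (2 - s - 2 * x)), 0]
  b := ![x, (2 - s) / 2 - (1 - s) * x, (1 - s) * (x - 1), (2 - s) / 2 - x]

theorem isEffectivelySymmetric_eesFamily {s x : ℝ} (hs : s ^ 2 = 2) (h1 : x - 1 ≠ 0)
    (h2 : 2 * x - 1 ≠ 0) (h3 : 1 - s - 2 * x ≠ 0) (h4 : 2 - s - 2 * x ≠ 0) (h5 : 2 * x + s ≠ 0)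
    {k : ℝ} (hk : k = (-2 + s * (1 - 2 * x)) / (4 * (x - 1))) :
    (eesFamily s x).IsEffectivelySymmetric s k (s * k - s / 2 + 1) (k + s / 2)
      ((eesFamily s x).A 2 1 * k)
      ((eesFamily s x).A 3 1 * k + (eesFamily s x).A 3 2 * (s * k - s / 2 + 1))
      ((eesFamily s x).A 3 2 * ((eesFamily s x).A 2 1 * k)) := by
  have hs0 : s ≠ 0 := by
    rintro rfl
    norm_num at hs
  -- With `k - 1`, `k`, `c₃`, `c₄`, `d₃`, `d₄`, `g₄` in factored form, each relation becomes a
  -- polynomial identity in `x` modulo `s² = 2`.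
  have hk1 : k - 1 = -(s + 2) * (2 * x - 1) / (4 * (x - 1)) := by
    rw [hk]
    field_simp
    ring
  have hs2 : s + 2 ≠ 0 := by
    intro h
    rw [show s = -2 by linarith] at hs
    norm_num at hs
  have ek : k = s * (1 - s - 2 * x) / (4 * (x - 1)) := by
    rw [hk]
    congr 1
    linear_combination hs
  have ec₃ : s * k - s / 2 + 1 = -s * (2 * x + s) / (4 * (x - 1)) := by
    rw [ek]
    field_simp
    linear_combination (4 - 4 * x - 2 * s) * hs
  have ec₄ : k + s / 2 = -(s + 2) / (4 * (x - 1)) := by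
    rw [ek]
    field_simp
    linear_combination (-2) * hs
  have ed₃ : (eesFamily s x).A 2 1 * k = (s - 1) * s * (2 * x + s) / (8 * (x - 1) * (2 * x - 1)) := by
    rw [ek]
    simp only [eesFamily, Matrix.of_apply, Matrix.cons_val]
    rw [show -2 * x - s + 1 = 1 - s - 2 * x by ring]
    field_simp
    ring
  have eg₄ : (eesFamily s x).A 3 2 * ((eesFamily s x).A 2 1 * k) =
      (3 - 2 * s) / (4 * (2 - s - 2 * x)) := by
    rw [ed₃]
    simp only [eesFamily, Matrix.of_apply, Matrix.cons_val]
    field_simp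
    linear_combination (12 - 4 * s) * hs
  have ed₄ : (eesFamily s x).A 3 1 * k + (eesFamily s x).A 3 2 * (s * k - s / 2 + 1) =
      -s / (4 * (2 * x - 1)) := by
    rw [ec₃, ek]
    simp only [eesFamily, Matrix.of_apply, Matrix.cons_val]
    field_simp
    linear_combination (-x) * hs
  refine ⟨?_, hs, ?_, hk.symm, ?_, ?_, rfl, rfl, rfl, rfl, rfl, ?_, ?_, ?_, ?_, ?_, ?_, ?_⟩
  · intro i j hij
    fin_cases i <;> fin_cases j <;> first | rfl | exact absurd hij (by decide)
  · exact sub_ne_zero.1 (hk1 ▸ div_ne_zero (mul_ne_zero (neg_ne_zero.2 hs2) h2)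
      (mul_ne_zero (by norm_num) h1))
  · rw [ec₃]
    simp only [eesFamily, Matrix.of_apply, Matrix.cons_val]
    rw [show -2 * x - s + 1 = 1 - s - 2 * x by ring]
    field_simp
    clear * - hs
    grind
  · rw [ec₄]
    simp only [eesFamily, Matrix.of_apply, Matrix.cons_val]
    rw [mul_one_div, mul_one_div, div_div,
      div_add_div _ _ (by simp [*]) (by simp [*]), div_add_div _ _ (by simp [*]) (by simp [*]),
      div_eq_div_iff (by simp [*]) (by simp [*])]
    clear * - hs
    grind
  · rw [ed₃, ec₃, hk1, ek]
    field_simp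
    clear * - hs
    grind
  · rw [ed₄, ec₄, hk1, ek]
    field_simp
    clear * - hs
    grind
  · rw [ed₄, eg₄, hk1, ek]
    field_simp
    clear * - hs
    grind
  · simp only [eesFamily, Matrix.cons_val]
    ring
  · rw [ec₃, ec₄, ek]
    simp only [eesFamily, Matrix.cons_val]
    field_simp
    clear * - hs
    grind
  · have h2' : x * 2 - 1 ≠ 0 := by rwa [mul_comm]
    rw [ed₃, ed₄]
    simp only [eesFamily, Matrix.cons_val]
    field_simp
    clear * - hs
    grind
  · rw [eg₄]
    simp only [eesFamily, Matrix.cons_val]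
    field_simp
    ring

/-- The relations form a triangular system: `s` and `k` fix the abscissae, then `d₃`, `d₄`, `g₄`,
then the matrix and the weights from the last stage back. The nonvanishing hypotheses are the
pivots. -/
theorem IsEffectivelySymmetric.eq_of_eq {Ψ Φ : RKScheme 4}
    {s k c₃ c₄ d₃ d₄ g₄ c₃' c₄' d₃' d₄' g₄' : ℝ}
    (H : Ψ.IsEffectivelySymmetric s k c₃ c₄ d₃ d₄ g₄)
    (H' : Φ.IsEffectivelySymmetric s k c₃' c₄' d₃' d₄' g₄') (hk : k ≠ 0) (hk2 : 2 * k - 1 ≠ 0)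
    (hd : d₃ ≠ 0) (hg : g₄ ≠ 0) : Ψ = Φ := by
  have hs1 : 1 + s ≠ 0 := by
    intro h
    have := H.sq
    rw [show s = -1 by linarith] at this
    norm_num at this
  have hk1 : -2 * (k - 1) ≠ 0 := mul_ne_zero (by norm_num) (sub_ne_zero.2 H.k_ne)
  obtain rfl : c₃ = c₃' := H.eq_c₃.trans H'.eq_c₃.symm
  obtain rfl : c₄ = c₄' := H.eq_c₄.trans H'.eq_c₄.symm
  obtain rfl : d₃ = d₃' := mul_left_cancel₀ hk1 (H.eq_d₃.symm.trans H'.eq_d₃)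
  obtain rfl : d₄ = d₄' := mul_left_cancel₀ hk1 (H.eq_d₄.symm.trans H'.eq_d₄)
  obtain rfl : g₄ = g₄' :=
    mul_left_cancel₀ (mul_ne_zero (neg_ne_zero.2 hs1) hk2) (H.eq_g₄.symm.trans H'.eq_g₄)
  have a10 := H.row₁.trans H'.row₁.symm
  have a21 : Ψ.A 2 1 = Φ.A 2 1 := mul_right_cancel₀ hk (H.row₂'.trans H'.row₂'.symm)
  have a20 : Ψ.A 2 0 = Φ.A 2 0 := by linarith [H.row₂, H'.row₂]
  have a32 : Ψ.A 3 2 = Φ.A 3 2 := mul_right_cancel₀ hd (H.row₃''.trans H'.row₃''.symm)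
  have a31 : Ψ.A 3 1 = Φ.A 3 1 := by
    refine mul_right_cancel₀ hk ?_
    have h1 := H.row₃'
    rw [a32] at h1
    linarith [H'.row₃']
  have a30 : Ψ.A 3 0 = Φ.A 3 0 := by linarith [H.row₃, H'.row₃]
  have b3 : Ψ.b 3 = Φ.b 3 := mul_right_cancel₀ hg (H.weight₃.trans H'.weight₃.symm)
  have b2 : Ψ.b 2 = Φ.b 2 := by
    refine mul_right_cancel₀ hd ?_
    have h1 := H.weight₂
    rw [b3] at h1
    linarith [H'.weight₂]
  have b1 : Ψ.b 1 = Φ.b 1 := by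
    refine mul_right_cancel₀ hk ?_
    have h1 := H.weight₁
    rw [b3, b2] at h1
    linarith [H'.weight₁]
  have b0 : Ψ.b 0 = Φ.b 0 := by linarith [H.weight₀, H'.weight₀]
  have e := H.explicit
  have e' := H'.explicit
  refine RKScheme.ext (funext fun i => funext fun j => ?_) (funext fun i => ?_)
  · rcases le_or_gt i j with hij | hij
    · rw [e i j hij, e' i j hij]
    · fin_cases i <;> fin_cases j <;>
        first | exact absurd hij (by decide) | assumption
  · fin_cases i <;> assumption

theorem eq_eesFamily_iff (Ψ : RKScheme 4) (s x : ℝ) : Ψ = eesFamily s x ↔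
    (∀ i j : Fin 4, i ≤ j → Ψ.A i j = 0) ∧
        Ψ.b 0 = x ∧
        Ψ.b 1 = (2 - s) / 2 - (1 - s) * x ∧
        Ψ.b 2 = (1 - s) * (x - 1) ∧
        Ψ.b 3 = (2 - s) / 2 - x ∧
        Ψ.A 1 0 = (-2 + s * (1 - 2 * x)) / (4 * (x - 1)) ∧
        Ψ.A 2 0 = (2 * x + s - 2) * (4 * x + s - 2) / (4 * s * (x - 1)) *
          ((2 * x + s) / ((2 * x - 1) * (-2 * x - s + 1))) ∧
        Ψ.A 2 1 = (-1 + s) / 2 * ((2 * x + s) / ((2 * x - 1) * (-2 * x - s + 1))) ∧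
        Ψ.A 3 0 = (-40 * x ^ 4 + (80 - 40 * s) * x ^ 3 - (88 - 60 * s) * x ^ 2
            + (48 - 34 * s) * x + 7 * s - 10) / (2 * (x - 1) * (2 * x + s)) *
          (1 / ((2 * x - 1) * (1 - s - 2 * x) * (2 - s - 2 * x))) ∧
        Ψ.A 3 1 = (2 - s) * x * (x - 1) * (4 * x + s - 2) *
          (1 / ((2 * x - 1) * (1 - s - 2 * x) * (2 - s - 2 * x))) ∧
        Ψ.A 3 2 = (2 - s) * (x - 1) * (2 * x - 1) / ((2 * x + s) * (2 - s - 2 * x)) := by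
  constructor
  · rintro rfl
    refine ⟨?_, rfl, rfl, rfl, rfl, rfl, rfl, rfl, rfl, rfl, rfl⟩
    intro i j hij
    fin_cases i <;> fin_cases j <;> first | rfl | exact absurd hij (by decide)
  · rintro ⟨e, b0, b1, b2, b3, a10, a20, a21, a30, a31, a32⟩
    refine RKScheme.ext (funext fun i => funext fun j => ?_) (funext fun i => ?_)
    · rcases le_or_gt i j with hij | hij
      · rw [e i j hij]
        fin_cases i <;> fin_cases j <;> first | rfl | exact absurd hij (by decide)
      · fin_cases i <;> fin_cases j <;>
          first | exact absurd hij (by decide) | assumption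
    · fin_cases i <;> assumption

/-- The conditions under which a scheme given by the relations belongs to the family. -/
theorem IsEffectivelySymmetric.eq_eesFamily {Ψ : RKScheme 4} {s k c₃ c₄ d₃ d₄ g₄ : ℝ}
    (H : Ψ.IsEffectivelySymmetric s k c₃ c₄ d₃ d₄ g₄) (hk : k ≠ 0) (hd : d₃ ≠ 0) (hg : g₄ ≠ 0) :
    ∃ x : ℝ, x ≠ 1 ∧ x ≠ 1 / 2 ∧ x ≠ (1 - s) / 2 ∧ x ≠ (2 - s) / 2 ∧ x ≠ -s / 2 ∧
      Ψ = eesFamily s x := by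
  have hs := H.sq
  have hne : ∀ r : ℝ, r ^ 2 ≠ 2 → s - r ≠ 0 := fun r hr h => hr (by
    rw [← sub_eq_zero.1 h, hs])
  have hs0 := hne 0 (by norm_num)
  have hs1 := hne (-1) (by norm_num)
  have hs2 := hne (-2) (by norm_num)
  have hs3 := hne 1 (by norm_num)
  have hk1 : k - 1 ≠ 0 := sub_ne_zero.2 H.k_ne
  rw [sub_zero] at hs0
  have hc₃ : c₃ ≠ 0 := fun h => by
    have h1 := H.eq_d₃
    rw [h, zero_mul] at h1
    exact mul_ne_zero (mul_ne_zero (by norm_num) hk1) hd h1.symm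
  have hc₃k : c₃ - k ≠ 0 := fun h => by
    have h1 := H.eq_d₃
    rw [h, mul_zero] at h1
    exact mul_ne_zero (mul_ne_zero (by norm_num) hk1) hd h1.symm
  have hy : 2 * k + s ≠ 0 := fun h => hc₃k (by
    rw [H.eq_c₃, show k = -s / 2 by linarith]
    linear_combination (-1 / 2) * hs)
  -- If `k = 1/2` then `d₄ = 0`, hence `c₄ (c₄ - k) = 0`; but `c₄ = (2k + s)/2` and `c₄ - k = s/2`
  -- are nonzero.
  have hk2 : 2 * k - 1 ≠ 0 := fun h => by
    have h1 := H.eq_g₄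
    rw [h, mul_zero, zero_mul] at h1
    have h2 : d₄ = 0 := (mul_eq_zero.1 h1).resolve_left
      (mul_ne_zero (fun h => hs3 (by linarith)) hk1)
    have h3 := H.eq_d₄
    rw [h2, mul_zero, H.eq_c₄] at h3
    refine mul_ne_zero ?_ ?_ h3
    · exact fun h => hy (by linarith)
    · exact fun h => hs0 (by linarith)
  -- This inverts the Möbius map `x ↦ a₂₁`; the pole `2k + s = 0` is the case `c₃ = k`, already
  -- excluded.
  obtain ⟨x, hx⟩ : ∃ x, x = (4 * k - 2 + s) / (2 * (2 * k + s)) := ⟨_, rfl⟩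
  have hy2 : 2 * (2 * k + s) ≠ 0 := mul_ne_zero two_ne_zero hy
  have hx1 : x * (2 * (2 * k + s)) = 4 * k - 2 + s := by rw [hx, div_mul_cancel₀ _ hy2]
  have e1 : x - 1 = -(s + 2) / (2 * (2 * k + s)) := by
    rw [eq_div_iff hy2]
    linear_combination hx1
  have e2 : 2 * x - 1 = 2 * (k - 1) / (2 * k + s) := by
    rw [eq_div_iff hy]
    linear_combination hx1
  have e3 : 1 - s - 2 * x = -2 * k * (1 + s) / (2 * k + s) := by
    rw [eq_div_iff hy]
    linear_combination -hx1 - hs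
  have e4 : 2 - s - 2 * x = s * (1 - 2 * k) / (2 * k + s) := by
    rw [eq_div_iff hy]
    linear_combination -hx1 - hs
  have e5 : 2 * x + s = 2 * (1 + s) * c₃ / (2 * k + s) := by
    rw [eq_div_iff hy, H.eq_c₃]
    linear_combination hx1 + (2 - 2 * k) * hs
  have n1 : x - 1 ≠ 0 := e1 ▸ div_ne_zero (fun h => hs2 (by linarith))
    (mul_ne_zero (by norm_num) hy)
  have n2 : 2 * x - 1 ≠ 0 := e2 ▸ div_ne_zero (mul_ne_zero (by norm_num) hk1) hy
  have n3 : 1 - s - 2 * x ≠ 0 := e3 ▸ div_ne_zero (mul_ne_zero (mul_ne_zero (by norm_num) hk)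
    (fun h => hs1 (by linarith))) hy
  have n4 : 2 - s - 2 * x ≠ 0 := e4 ▸ div_ne_zero (mul_ne_zero hs0
    (fun h => hk2 (by linarith))) hy
  have n5 : 2 * x + s ≠ 0 := e5 ▸ div_ne_zero (mul_ne_zero
    (mul_ne_zero (by norm_num) (fun h => hs1 (by linarith))) hc₃) hy
  have hkx : k = (-2 + s * (1 - 2 * x)) / (4 * (x - 1)) := by
    rw [eq_div_iff (mul_ne_zero (by norm_num) n1)]
    linarith
  refine ⟨x, ?_, ?_, ?_, ?_, ?_, H.eq_of_eq
    (isEffectivelySymmetric_eesFamily hs n1 n2 n3 n4 n5 hkx) hk hk2 hd hg⟩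
  · exact fun h => n1 (by linarith)
  · exact fun h => n2 (by linarith)
  · exact fun h => n3 (by linarith)
  · exact fun h => n4 (by linarith)
  · exact fun h => n5 (by linarith)

end RKScheme

theorem mainTheorem8 (Ψ : RKScheme 4) :
    Ψ.IsEES 2 7 ↔
      ∃ s x : ℝ, (s = √2 ∨ s = -√2) ∧
        x ≠ 1 ∧ x ≠ 1 / 2 ∧ x ≠ (1 - s) / 2 ∧ x ≠ (2 - s) / 2 ∧ x ≠ -s / 2 ∧
        (∀ i j : Fin 4, i ≤ j → Ψ.A i j = 0) ∧
        Ψ.b 0 = x ∧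
        Ψ.b 1 = (2 - s) / 2 - (1 - s) * x ∧
        Ψ.b 2 = (1 - s) * (x - 1) ∧
        Ψ.b 3 = (2 - s) / 2 - x ∧
        Ψ.A 1 0 = (-2 + s * (1 - 2 * x)) / (4 * (x - 1)) ∧
        Ψ.A 2 0 = (2 * x + s - 2) * (4 * x + s - 2) / (4 * s * (x - 1)) *
          ((2 * x + s) / ((2 * x - 1) * (-2 * x - s + 1))) ∧
        Ψ.A 2 1 = (-1 + s) / 2 * ((2 * x + s) / ((2 * x - 1) * (-2 * x - s + 1))) ∧
        Ψ.A 3 0 = (-40 * x ^ 4 + (80 - 40 * s) * x ^ 3 - (88 - 60 * s) * x ^ 2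
            + (48 - 34 * s) * x + 7 * s - 10) / (2 * (x - 1) * (2 * x + s)) *
          (1 / ((2 * x - 1) * (1 - s - 2 * x) * (2 - s - 2 * x))) ∧
        Ψ.A 3 1 = (2 - s) * x * (x - 1) * (4 * x + s - 2) *
          (1 / ((2 * x - 1) * (1 - s - 2 * x) * (2 - s - 2 * x))) ∧
        Ψ.A 3 2 = (2 - s) * (x - 1) * (2 * x - 1) / ((2 * x + s) * (2 - s - 2 * x)) := by
  simp only [← RKScheme.eq_eesFamily_iff]
  constructor
  · intro h
    obtain ⟨s, k, c₃, c₄, d₃, d₄, g₄, H, hk, hd, hg⟩ := h.exists_isEffectivelySymmetric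
    obtain ⟨x, hx⟩ := H.eq_eesFamily hk hd hg
    refine ⟨s, x, ?_, hx⟩
    rw [← sq_eq_sq_iff_eq_or_eq_neg, H.sq, Real.sq_sqrt (by norm_num)]
  · rintro ⟨s, x, hs, h1, h2, h3, h4, h5, rfl⟩
    have hs2 : s ^ 2 = 2 := by
      rw [← sq_eq_sq_iff_eq_or_eq_neg, Real.sq_sqrt (by norm_num)] at hs
      exact hs
    exact (RKScheme.isEffectivelySymmetric_eesFamily hs2 (fun h => h1 (by linarith))
      (fun h => h2 (by linarith)) (fun h => h3 (by linarith)) (fun h => h4 (by linarith))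
      (fun h => h5 (by linarith)) rfl).isEES
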